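/- For complex $x$ with $\Re x>0$ let $E_1(x)=\int_x^\infty \frac{e^{-t}}{t}\,dt$ (integral along the horizontal ray from $x$ to $+\infty$), and for $|z|<1$ let \[ f_0(z)=e^{z/(1-z)},\qquad f_1(z)=e^{x}E_1(x)\ \text{ with } x=\frac1{1-z}. \] Let $a_n=[z^n]f_0(z)$ and $b_n=[z^n]f_1(z)$ be their Maclaurin coefficients, and let $\rho_n=a_nb_n$ be the coefficients of the Hadamard product $f_0\odot f_1$. Define the formal power series $\mu(h)=h^{-1}-(e^h-1)^{-1}-\tfrac12\in\mathbb{Q}[[h]]$ (the polar parts cancel and $\mu(0)=0$) and, for $m\ge 0$ and $k\ge 0$, the rational numbers \[ c_m=(-1)^m\sum_{j=0}^m\,[h^{m-j}]\exp(\mu(h))\;\frac{(m-2j+3/2)_{2j}}{4^j\,j!},\qquad d_k=\sum_{j=0}^{2k}(-1)^j c_j c_{2k-j}, \] where $(x)_n=x(x+1)\cdots(x+n-1)$. Then $d_0=1$ and, as $n\to\infty$, \[ \rho_n\sim-\frac{1}{2n^{3/2}}\sum_{k\ge0}d_k n^{-k} \] as an asymptotic series in the sense of Poincar\'e; that is,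 for every fixed integer $m\ge 0$, \[ \rho_n=-\frac{1}{2n^{3/2}}\sum_{k=0}^{m-1}d_k n^{-k}+O\bigl(n^{-3/2-m}\bigr)\qquad(n\to\infty). \] -/

import Mathlib

open scoped PowerSeries LaurentSeries

namespace ExpIntegral

noncomputable section

/-- The exponential integral `E₁(x) = ∫_x^∞ e^{-t} / t dt` for complex `x` with `Re x > 0`, taken
along the horizontal ray `t = x + s`, `s > 0`. -/
def E₁ (x : ℂ) : ℂ :=
  ∫ s in Set.Ioi (0 : ℝ), Complex.exp (-(x + (s : ℂ))) / (x + (s : ℂ))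

/-- `f₀(z) = exp (z / (1 - z))`. -/
def f₀ (z : ℂ) : ℂ := Complex.exp (z / (1 - z))

/-- `f₁(z) = e^x E₁(x)` with `x = 1 / (1 - z)`; for `|z| < 1` one has `Re x > 1 / 2`. -/
def f₁ (z : ℂ) : ℂ := Complex.exp (1 / (1 - z)) * E₁ (1 / (1 - z))

/-- The `n`-th Maclaurin coefficient `[z^n] f(z)`. -/
def maclaurinCoeff (f : ℂ → ℂ) (n : ℕ) : ℂ := iteratedDeriv n f 0 / (n.factorial : ℂ)

/-- `a_n = [z^n] f₀(z)`. -/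
def a (n : ℕ) : ℂ := maclaurinCoeff f₀ n

/-- `b_n = [z^n] f₁(z)`. -/
def b (n : ℕ) : ℂ := maclaurinCoeff f₁ n

/-- The coefficients `ρ_n = a_n b_n` of the Hadamard product of `f₀` and `f₁`. -/
def rho (n : ℕ) : ℂ := a n * b n

/-- `h⁻¹ - (e^h - 1)⁻¹ - 1/2` in the field of formal Laurent series in `h` over `ℚ`. -/
def muLaurent : ℚ⸨X⸩ :=
  ((PowerSeries.X : ℚ⟦X⟧) : ℚ⸨X⸩)⁻¹ - ((PowerSeries.exp ℚ - 1 : ℚ⟦X⟧) : ℚ⸨X⸩)⁻¹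
    - ((PowerSeries.C (1 / 2 : ℚ) : ℚ⟦X⟧) : ℚ⸨X⸩)

/-- `μ(h) = h⁻¹ - (e^h - 1)⁻¹ - 1/2` as a formal power series; the polar parts cancel, see
`coe_mu`. -/
def mu : ℚ⟦X⟧ := PowerSeries.mk fun n => muLaurent.coeff (n : ℤ)

theorem muLaurent_eq : muLaurent =
    HahnSeries.single (-1 : ℤ) (1 : ℚ) * ((1 - bernoulliPowerSeries ℚ : ℚ⟦X⟧) : ℚ⸨X⸩)
      - ((PowerSeries.C (1 / 2 : ℚ) : ℚ⟦X⟧) : ℚ⸨X⸩) := by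
  have hB : ((bernoulliPowerSeries ℚ : ℚ⟦X⟧) : ℚ⸨X⸩) * ((PowerSeries.exp ℚ - 1 : ℚ⟦X⟧) : ℚ⸨X⸩)
      = ((PowerSeries.X : ℚ⟦X⟧) : ℚ⸨X⸩) := by
    rw [← PowerSeries.coe_mul, bernoulliPowerSeries_mul_exp_sub_one]
  have hX : ((PowerSeries.X : ℚ⟦X⟧) : ℚ⸨X⸩) ≠ 0 := by
    rw [PowerSeries.coe_X]; simp
  have hE : ((PowerSeries.exp ℚ - 1 : ℚ⟦X⟧) : ℚ⸨X⸩) ≠ 0 := by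
    intro h
    rw [h, mul_zero] at hB
    exact hX hB.symm
  have hs : HahnSeries.single (-1 : ℤ) (1 : ℚ) = ((PowerSeries.X : ℚ⟦X⟧) : ℚ⸨X⸩)⁻¹ := by
    rw [PowerSeries.coe_X, HahnSeries.inv_single, inv_one]
  have hinv : ((PowerSeries.exp ℚ - 1 : ℚ⟦X⟧) : ℚ⸨X⸩)⁻¹
      = ((PowerSeries.X : ℚ⟦X⟧) : ℚ⸨X⸩)⁻¹ * ((bernoulliPowerSeries ℚ : ℚ⟦X⟧) : ℚ⸨X⸩) := by
    rw [← hB] at hX ⊢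
    field_simp
    exact (div_self (left_ne_zero_of_mul hX)).symm
  rw [muLaurent, hinv, hs, PowerSeries.coe_sub, PowerSeries.coe_one]
  ring

theorem coeff_mu (n : ℕ) : PowerSeries.coeff n mu =
    PowerSeries.coeff (n + 1) (1 - bernoulliPowerSeries ℚ)
      - PowerSeries.coeff n (PowerSeries.C (1 / 2 : ℚ)) := by
  rw [mu, PowerSeries.coeff_mk, muLaurent_eq, HahnSeries.coeff_sub]
  congr 1
  · have h := HahnSeries.coeff_single_mul_add (r := (1 : ℚ))
      (x := ((1 - bernoulliPowerSeries ℚ : ℚ⟦X⟧) : ℚ⸨X⸩)) (a := ((n + 1 : ℕ) : ℤ)) (b := (-1 : ℤ))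
    have e : (((n + 1 : ℕ) : ℤ) + -1) = (n : ℤ) := by push_cast; ring
    rw [e, one_mul] at h
    rw [h]
    exact LaurentSeries.coeff_coe_powerSeries _ _
  · exact LaurentSeries.coeff_coe_powerSeries _ _

/-- The power series `mu` is the Laurent series `h⁻¹ - (e^h - 1)⁻¹ - 1/2`. -/
theorem coe_mu : (mu : ℚ⸨X⸩) = muLaurent := by
  have h : (1 - bernoulliPowerSeries ℚ : ℚ⟦X⟧) =
      PowerSeries.X * (mu + PowerSeries.C (1 / 2 : ℚ)) := by
    ext n
    cases n with
    | zero => simp [bernoulliPowerSeries]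
    | succ n => rw [PowerSeries.coeff_succ_X_mul, map_add, coeff_mu, sub_add_cancel]
  rw [muLaurent_eq, h, PowerSeries.coe_mul, ← mul_assoc, PowerSeries.coe_X,
    HahnSeries.single_mul_single]
  simp

/-- `μ(0) = 0`, so `μ` may be substituted into the exponential series. -/
theorem hasSubst_mu : PowerSeries.HasSubst mu := by
  apply PowerSeries.HasSubst.of_constantCoeff_zero'
  rw [← PowerSeries.coeff_zero_eq_constantCoeff_apply, coeff_mu]
  simp [bernoulliPowerSeries, PowerSeries.coeff_one]
  norm_num

/-- The power series `exp (μ(h))`. -/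
def expMu : ℚ⟦X⟧ := (PowerSeries.exp ℚ).subst mu

/-- `c_m = (-1)^m ∑_{j=0}^m [h^{m-j}] exp (μ(h)) · (m - 2j + 3/2)_{2j} / (4^j j!)`, where
`(x)_n = x (x + 1) ⋯ (x + n - 1)`. -/
def c (m : ℕ) : ℚ :=
  (-1) ^ m * ∑ j ∈ Finset.range (m + 1), PowerSeries.coeff (m - j) expMu *
    ((ascPochhammer ℚ (2 * j)).eval ((m : ℚ) - 2 * (j : ℚ) + 3 / 2) /
      (4 ^ j * (j.factorial : ℚ)))

/-- `d_k = ∑_{j=0}^{2k} (-1)^j c_j c_{2k-j}`. -/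
def d (k : ℕ) : ℚ :=
  ∑ j ∈ Finset.range (2 * k + 1), (-1) ^ j * c j * c (2 * k - j)

end

end ExpIntegral

namespace ExpIntegral

open Filter Topology Asymptotics MeasureTheory
open scoped ContDiff

/-! The key is that `a_n` and `b_n` solve the same second-order recurrence, so that only the
recessive solution `b_n` has to be expanded by analysis. Integrating a geometric series gives
`b_{k+1} = -bInt k`, and the substitution `s = 1/(e^h - 1)` turns `bInt k` into `e^{1/2} ∫ exp(μ(h))
e^{-1/h - (k+1)h} dh` over `h > 0`. Expanding `exp(μ(h))` at `0` leaves Macdonald integrals. Their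
expansions come from Watson's lemma in orders 0 and 1 and from the recurrence in the order
(`hasAsymp_macdonald`). With `n = k + 1`, this gives `bInt k` as a constant times `n^{-3/4}
e^{-2√n}` times a series in `t = n^{-1/2}` with coefficients `(-1)^m c_m` (`hasAsymp_expMuInt`,
`bInt_eq_betaSeq`). The dominant solution should have the same series with `t` replaced by `-t`.
Indeed, putting a truncation `P` into the recurrence leaves a residual analytic in `t = ε/√n`, the
same function for both signs `ε`. It is small at `0⁺` because `bInt` is an exact solution, hence
also at `0⁻` (`isBigO_residual`). Two approximate solutions result; `n(n+1)` times their Casoratian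
is `2` up to a high power of `1/n` (`isBigO_approxCasoratian`). The exact Casoratian of `a` and
`bInt` is `1/(n(n+1))` (`casoratian`). The quotient `a/bInt` therefore has increments that are known
to any power of `1/n`. Summing them against the fast growth of `e^{4√n}` determines the quotient
(`isBigO_quotDiff`), and any additive constant is negligible. Multiplying by `bInt²` gives `a_n
bInt(n-1) ≈ t³ P(t) P(-t) / 2`. The product `P(t) P(-t)` is even, and its coefficients are the
`d_k`. -/

/-- `f ~ F(τ)` along `l`: the function `f` has the formal power series `F` in the small quantity
`τ` as its Poincaré asymptotic expansion. -/
def HasAsymp {ι : Type*} (l : Filter ι) (τ f : ι → ℝ) (F : ℝ⟦X⟧) : Prop :=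
  ∀ N : ℕ, (fun i => f i - (PowerSeries.trunc N F).eval (τ i)) =O[l] fun i => τ i ^ N

/-! ### Arithmetic of Poincaré expansions. -/

section HasAsymp

variable {ι : Type*} {l : Filter ι} {τ f g : ι → ℝ} {F G : ℝ⟦X⟧}

theorem eval_trunc (N : ℕ) (F : ℝ⟦X⟧) (x : ℝ) : (PowerSeries.trunc N F).eval x =
    ∑ k ∈ Finset.range N, PowerSeries.coeff k F * x ^ k :=
  PowerSeries.eval₂_trunc_eq_sum_range x (RingHom.id ℝ) N F

theorem isBigO_pow_pow_of_le (hτ : Tendsto τ l (𝓝 0)) {m n : ℕ} (h : m ≤ n) :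
    (fun i => τ i ^ n) =O[l] fun i => τ i ^ m := by
  obtain ⟨k, rfl⟩ := Nat.exists_eq_add_of_le h
  have h1 : (fun i => τ i ^ k) =O[l] fun _ => (1 : ℝ) := (hτ.pow k).isBigO_one ℝ
  simpa [pow_add] using (isBigO_refl (fun i => τ i ^ m) l).mul h1

theorem isBigO_eval (hτ : Tendsto τ l (𝓝 0)) (p : Polynomial ℝ) :
    (fun i => p.eval (τ i)) =O[l] fun _ => (1 : ℝ) :=
  ((p.continuous.tendsto 0).comp hτ).isBigO_one ℝ

theorem isBigO_eval_of_coeff_eq_zero (hτ : Tendsto τ l (𝓝 0)) {p : Polynomial ℝ} {N : ℕ}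
    (h : ∀ k < N, p.coeff k = 0) : (fun i => p.eval (τ i)) =O[l] fun i => τ i ^ N := by
  obtain ⟨q, rfl⟩ := Polynomial.X_pow_dvd_iff.2 h
  simpa using (isBigO_refl (fun i => τ i ^ N) l).mul (isBigO_eval hτ q)

/-- Any polynomial agreeing with `F` below degree `N` may replace the truncation, since the
difference is divisible by `X ^ N`. Products and compositions thus need no explicit truncation. -/
theorem isBigO_sub_eval_trunc (hτ : Tendsto τ l (𝓝 0)) {N : ℕ} {p : Polynomial ℝ}
    (hp : ∀ k < N, p.coeff k = PowerSeries.coeff k F)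
    (h : (fun i => f i - p.eval (τ i)) =O[l] fun i => τ i ^ N) :
    (fun i => f i - (PowerSeries.trunc N F).eval (τ i)) =O[l] fun i => τ i ^ N := by
  have h2 := isBigO_eval_of_coeff_eq_zero hτ (p := p - PowerSeries.trunc N F) (N := N)
    (fun k hk => by simp [PowerSeries.coeff_trunc, hk, hp k hk])
  refine (h.add h2).congr_left fun i => ?_
  simp

theorem HasAsymp.add (hf : HasAsymp l τ f F) (hg : HasAsymp l τ g G) :
    HasAsymp l τ (fun i => f i + g i) (F + G) := fun N => by
  refine ((hf N).add (hg N)).congr_left fun i => ?_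
  simp
  ring

theorem HasAsymp.const_mul (hf : HasAsymp l τ f F) (r : ℝ) :
    HasAsymp l τ (fun i => r * f i) (PowerSeries.C r * F) := fun N => by
  refine ((hf N).const_mul_left r).congr_left fun i => ?_
  simp [PowerSeries.trunc_C_mul]
  ring

theorem HasAsymp.sub (hf : HasAsymp l τ f F) (hg : HasAsymp l τ g G) :
    HasAsymp l τ (fun i => f i - g i) (F - G) := fun N => by
  refine ((hf N).sub (hg N)).congr_left fun i => ?_
  simp
  ring

theorem HasAsymp.congr' (hf : HasAsymp l τ f F) (h : f =ᶠ[l] g) : HasAsymp l τ g F := fun N => by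
  refine (hf N).congr' ?_ EventuallyEq.rfl
  filter_upwards [h] with i hi
  rw [hi]

theorem HasAsymp.comp {κ : Type*} {l' : Filter κ} {u : κ → ι} (hf : HasAsymp l τ f F)
    (hu : Tendsto u l' l) : HasAsymp l' (fun k => τ (u k)) (fun k => f (u k)) F := fun N =>
  (hf N).comp_tendsto hu

theorem HasAsymp.isBigO_one (hf : HasAsymp l τ f F) : f =O[l] fun _ => (1 : ℝ) := by
  simpa using hf 0

theorem HasAsymp.mul (hτ : Tendsto τ l (𝓝 0)) (hf : HasAsymp l τ f F) (hg : HasAsymp l τ g G) :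
    HasAsymp l τ (fun i => f i * g i) (F * G) := fun N => by
  apply isBigO_sub_eval_trunc hτ (p := PowerSeries.trunc N F * PowerSeries.trunc N G)
  · intro k hk
    rw [PowerSeries.coeff_mul_eq_coeff_trunc_mul_trunc F G hk, ← Polynomial.coe_mul,
      Polynomial.coeff_coe]
  · have h1 := hf.isBigO_one.mul (hg N)
    have h2 := (hf N).mul (isBigO_eval hτ (PowerSeries.trunc N G))
    simp only [one_mul, mul_one] at h1 h2
    refine (h1.add h2).congr_left fun i => ?_
    simp
    ring

theorem hasAsymp_poly (hτ : Tendsto τ l (𝓝 0)) (p : Polynomial ℝ) :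
    HasAsymp l τ (fun i => p.eval (τ i)) (p : ℝ⟦X⟧) := fun N => by
  apply isBigO_sub_eval_trunc hτ (p := p) (by simp)
  simpa using isBigO_zero _ _

theorem hasAsymp_const (hτ : Tendsto τ l (𝓝 0)) (r : ℝ) :
    HasAsymp l τ (fun _ => r) (PowerSeries.C r) := by
  simpa using hasAsymp_poly hτ (Polynomial.C r)

theorem hasAsymp_self (hτ : Tendsto τ l (𝓝 0)) : HasAsymp l τ τ PowerSeries.X := by
  simpa using hasAsymp_poly hτ Polynomial.X

theorem HasAsymp.pow (hτ : Tendsto τ l (𝓝 0)) (hf : HasAsymp l τ f F) (n : ℕ) :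
    HasAsymp l τ (fun i => f i ^ n) (F ^ n) := by
  induction n with
  | zero => simpa using hasAsymp_const hτ 1
  | succ n ih => simpa [pow_succ] using ih.mul hτ hf

theorem hasAsymp_sum (hτ : Tendsto τ l (𝓝 0)) {κ : Type*} (s : Finset κ) {u : κ → ι → ℝ}
    {U : κ → ℝ⟦X⟧} (h : ∀ k ∈ s, HasAsymp l τ (u k) (U k)) :
    HasAsymp l τ (fun i => ∑ k ∈ s, u k i) (∑ k ∈ s, U k) := by
  classical
  induction s using Finset.induction_on with
  | empty => simpa using hasAsymp_const hτ 0
  | insert a s ha ih =>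
    simp only [Finset.sum_insert ha]
    exact (h a (by simp)).add (ih fun k hk => h k (by simp [hk]))

/-- Reciprocals: up to `O(τ^N)`, `f - trunc F` is `f (1 - g · trunc F)`, where `f` is bounded and
the bracket is small because `F G = 1`. -/
theorem HasAsymp.of_mul_eq_one (hτ : Tendsto τ l (𝓝 0)) (hg : HasAsymp l τ g G)
    (hf : f =O[l] fun _ => (1 : ℝ)) (hfg : ∀ᶠ i in l, f i * g i = 1) (hFG : F * G = 1) :
    HasAsymp l τ f F := fun N => by
  have h1 : HasAsymp l τ (fun i => (PowerSeries.trunc N F).eval (τ i) * g i)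
      ((PowerSeries.trunc N F : ℝ⟦X⟧) * G) := (hasAsymp_poly hτ _).mul hτ hg
  have h2 := hf.mul (isBigO_sub_eval_trunc hτ (p := (PowerSeries.trunc N (1 : ℝ⟦X⟧)))
      (F := (1 : ℝ⟦X⟧)) (f := fun i => (PowerSeries.trunc N F).eval (τ i) * g i) (N := N)
      (fun k hk => by simp [PowerSeries.coeff_trunc, hk]) (by
        have := h1 N
        rwa [PowerSeries.trunc_trunc_mul, hFG] at this))
  have h3 : (fun i => (1 : ℝ) - (PowerSeries.trunc N (1 : ℝ⟦X⟧)).eval (τ i)) =O[l]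
      fun i => τ i ^ N := by simpa using hasAsymp_const hτ 1 N
  have h4 := hf.mul h3
  simp only [one_mul] at h2 h4
  refine (h4.sub h2).congr' ?_ EventuallyEq.rfl
  filter_upwards [hfg] with i hi
  have : f i * ((PowerSeries.trunc N F).eval (τ i) * g i)
      = (f i * g i) * (PowerSeries.trunc N F).eval (τ i) := by ring
  rw [mul_sub, mul_sub, this, hi]
  ring

/-- Removes a factor `τ` at the cost of one order, which is recovered by using the hypothesis at `N
+ 1`. -/
theorem HasAsymp.of_X_mul (hτ0 : ∀ᶠ i in l, τ i ≠ 0)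
    (hf : HasAsymp l τ (fun i => τ i * f i) (PowerSeries.X * F)) : HasAsymp l τ f F := fun N => by
  have h := hf (N + 1)
  have h1 : ∀ x : ℝ, (PowerSeries.trunc (N + 1) (PowerSeries.X * F)).eval x =
      x * (PowerSeries.trunc N F).eval x := by
    have : PowerSeries.trunc (N + 1) (PowerSeries.X * F)
        = Polynomial.X * PowerSeries.trunc N F := by
      ext k
      cases k <;> simp [PowerSeries.coeff_trunc, PowerSeries.coeff_succ_X_mul]
    intro x
    simp [this]
  have h2 := (isBigO_refl (fun i => (τ i)⁻¹) l).mul h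
  refine h2.congr' ?_ ?_
  · filter_upwards [hτ0] with i hi
    rw [h1]
    field_simp
  · filter_upwards [hτ0] with i hi
    field_simp
    ring

theorem hasAsymp_of_hasFPowerSeriesAt {φ : ℝ → ℝ} {c : ℕ → ℝ}
    (h : HasFPowerSeriesAt φ (.ofScalars ℝ c) 0) :
    HasAsymp (𝓝 0) id φ (PowerSeries.mk c) := fun N => by
  have h1 := h.isBigO_sub_partialSum_pow N
  refine (h1.trans (isBigO_of_le _ fun x => by simp)).congr_left fun x => ?_
  simp [FormalMultilinearSeries.partialSum, eval_trunc, mul_comm]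

theorem hasAsymp_exp : HasAsymp (𝓝 0) id Real.exp (PowerSeries.exp ℝ) := by
  have h : HasFPowerSeriesAt Real.exp
      (.ofScalars ℝ fun n => ((n.factorial : ℝ)⁻¹)) 0 := by
    have := NormedSpace.exp_hasFPowerSeriesAt_zero (𝕂 := ℝ) (𝔸 := ℝ)
    rw [← Real.exp_eq_exp_ℝ] at this
    have h2 : NormedSpace.expSeries ℝ ℝ = .ofScalars ℝ fun n => ((n.factorial : ℝ)⁻¹) := by
      rw [NormedSpace.expSeries_eq_ofScalars]
    rwa [h2] at this
  convert hasAsymp_of_hasFPowerSeriesAt h using 1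
  ext n
  simp [PowerSeries.coeff_exp]

/-- Since `F` has no constant term, `f = O(τ)`. Truncating the exponential series at `N` thus costs
`O(τ^N)`, and the powers `F ^ k` with `k ≥ N` do not reach degrees below `N`. -/
theorem HasAsymp.exp (hτ : Tendsto τ l (𝓝 0)) (hf : HasAsymp l τ f F)
    (hF : PowerSeries.constantCoeff F = 0) :
    HasAsymp l τ (fun i => Real.exp (f i)) ((PowerSeries.exp ℝ).subst F) := fun N => by
  have hfτ : f =O[l] τ := by
    have h := hf 1
    simpa [PowerSeries.trunc_one_left, hF] using h
  have hf0 : Tendsto f l (𝓝 0) := hfτ.trans_tendsto hτ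
  have h1 := ((hasAsymp_exp N).comp_tendsto hf0).trans (hfτ.pow N)
  simp only [Function.comp_def, id] at h1
  have h2 : HasAsymp l τ (fun i => ∑ k ∈ Finset.range N, (k.factorial : ℝ)⁻¹ * f i ^ k)
      (∑ k ∈ Finset.range N, PowerSeries.C (k.factorial : ℝ)⁻¹ * F ^ k) :=
    hasAsymp_sum hτ _ fun k _ => (hf.pow hτ k).const_mul _
  have h3 : PowerSeries.trunc N (∑ k ∈ Finset.range N, PowerSeries.C (k.factorial : ℝ)⁻¹ * F ^ k)
      = PowerSeries.trunc N ((PowerSeries.exp ℝ).subst F) := by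
    ext m
    rw [PowerSeries.coeff_trunc, PowerSeries.coeff_trunc]
    split_ifs with hm
    · rw [PowerSeries.coeff_subst' (PowerSeries.HasSubst.of_constantCoeff_zero' hF),
        finsum_eq_sum_of_support_subset (s := Finset.range N)]
      · simp [PowerSeries.coeff_exp]
      · intro k hk
        simp only [Function.mem_support] at hk
        simp only [Finset.coe_range, Set.mem_Iio]
        by_contra hkN
        apply hk
        have : PowerSeries.coeff m (F ^ k) = 0 := by
          obtain ⟨Q, rfl⟩ := PowerSeries.X_dvd_iff.2 hF
          rw [mul_pow, PowerSeries.coeff_X_pow_mul']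
          simp
          omega
        simp [this]
    · rfl
  have h4 := h2 N
  rw [h3] at h4
  refine (h1.add h4).congr_left fun i => ?_
  have : (PowerSeries.trunc N (PowerSeries.exp ℝ)).eval (f i)
      = ∑ k ∈ Finset.range N, (k.factorial : ℝ)⁻¹ * f i ^ k := by
    simp [eval_trunc, PowerSeries.coeff_exp]
  rw [this]
  ring

end HasAsymp

/-! ### The function exp(μ(h)) and its expansion at 0⁺. -/

theorem tendsto_id_nhdsGT_zero : Tendsto (id : ℝ → ℝ) (𝓝[>] 0) (𝓝 0) :=
  tendsto_id'.2 nhdsWithin_le_nhds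

theorem HasAsymp.of_succ {ι : Type*} {l : Filter ι} {τ f : ι → ℝ} {F : ℝ⟦X⟧}
    (hτ : Tendsto τ l (𝓝 0))
    (h : ∀ N : ℕ, (fun i => f i - (PowerSeries.trunc (N + 1) F).eval (τ i)) =O[l]
      fun i => τ i ^ (N + 1)) : HasAsymp l τ f F := fun N =>
  isBigO_sub_eval_trunc hτ (p := PowerSeries.trunc (N + 1) F)
    (fun k hk => by simp [PowerSeries.coeff_trunc, Nat.lt_succ_of_lt hk])
    ((h N).trans (isBigO_pow_pow_of_le hτ N.le_succ))

/-- An asymptotic expansion at `0⁺` of a function of at most linear growth has remainders that are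
controlled on the whole half line. -/
theorem HasAsymp.exists_bound {φ : ℝ → ℝ} {F : ℝ⟦X⟧} (h : HasAsymp (𝓝[>] 0) id φ F)
    (hφ : ∀ δ > 0, ∃ A, ∀ y, δ ≤ y → |φ y| ≤ A * (1 + y)) (N : ℕ) :
    ∃ C, 0 ≤ C ∧ ∀ y, 0 < y →
      |φ y - (PowerSeries.trunc (N + 1) F).eval y| ≤ C * y ^ (N + 1) := by
  obtain ⟨C, hC⟩ := (h (N + 1)).bound
  obtain ⟨δ, hδ, hδC⟩ := mem_nhdsGT_iff_exists_Ioo_subset.1 hC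
  simp only [Set.mem_Ioi] at hδ
  obtain ⟨A, hA⟩ := hφ δ hδ
  set S := ∑ k ∈ Finset.range (N + 1), |PowerSeries.coeff k F| * δ ^ k
  have hS : 0 ≤ S := by positivity
  refine ⟨max C 0 + (|A| * (1 + δ) + S) / δ ^ (N + 1), by positivity, fun y hy => ?_⟩
  rcases lt_or_ge y δ with hyδ | hyδ
  · have h1 := hδC ⟨hy, hyδ⟩
    simp only [id, Real.norm_eq_abs, Set.mem_ofPred_eq, abs_pow, abs_of_pos hy] at h1
    refine h1.trans ?_
    gcongr
    have : 0 ≤ (|A| * (1 + δ) + S) / δ ^ (N + 1) := by positivity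
    linarith [le_max_left C 0]
  · have hr : 1 ≤ y / δ := (one_le_div hδ).2 hyδ
    -- Beyond `δ` every lower power is dominated by a multiple of `y ^ (N + 1)`. The cases `k = 0,
    -- 1` absorb the linear growth of `φ`, the others absorb the truncation.
    have hpow : ∀ k ≤ N + 1, y ^ k ≤ δ ^ k * (y / δ) ^ (N + 1) := fun k hk => by
      calc y ^ k = δ ^ k * (y / δ) ^ k := by rw [← mul_pow]; congr 1; field_simp
        _ ≤ _ := by gcongr
    have h1 : |φ y| ≤ |A| * (1 + δ) * (y / δ) ^ (N + 1) := by
      have h0 := hpow 0 (by omega)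
      have h1 := hpow 1 (by omega)
      simp only [pow_zero, pow_one, one_mul] at h0 h1
      calc |φ y| ≤ A * (1 + y) := hA y hyδ
        _ ≤ |A| * (1 + y) := by gcongr; exact le_abs_self A
        _ ≤ |A| * ((1 + δ) * (y / δ) ^ (N + 1)) := by gcongr; linarith
        _ = _ := by ring
    have h2 : |(PowerSeries.trunc (N + 1) F).eval y| ≤ S * (y / δ) ^ (N + 1) := by
      rw [eval_trunc, Finset.sum_mul]
      refine (Finset.abs_sum_le_sum_abs _ _).trans (Finset.sum_le_sum fun k hk => ?_)
      rw [abs_mul, abs_pow, abs_of_pos hy, mul_assoc]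
      gcongr
      exact hpow k (Finset.mem_range.1 hk).le
    calc |φ y - (PowerSeries.trunc (N + 1) F).eval y|
        ≤ |φ y| + |(PowerSeries.trunc (N + 1) F).eval y| := abs_sub _ _
      _ ≤ (|A| * (1 + δ) + S) * (y / δ) ^ (N + 1) := by linarith
      _ = 0 * y ^ (N + 1) + (|A| * (1 + δ) + S) / δ ^ (N + 1) * y ^ (N + 1) := by
        rw [div_pow]; ring
      _ ≤ _ := by
        rw [← add_mul]
        gcongr
        exact le_max_right _ _

/-- The function `exp (μ(h))` for `h > 0`. -/
noncomputable def expMuFun (h : ℝ) : ℝ := Real.exp (h⁻¹ - (Real.exp h - 1)⁻¹ - 1 / 2)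

/-- The Bernoulli series is `h/(e^h - 1)`, so this expresses the cancellation of the polar parts of
`μ` without Laurent series. -/
theorem one_sub_bernoulliPowerSeries : (1 - bernoulliPowerSeries ℚ : ℚ⟦X⟧) =
    PowerSeries.X * (mu + PowerSeries.C (1 / 2 : ℚ)) := by
  ext n
  cases n with
  | zero => simp [bernoulliPowerSeries]
  | succ n => rw [PowerSeries.coeff_succ_X_mul, map_add, coeff_mu, sub_add_cancel]

theorem constantCoeff_mu : PowerSeries.constantCoeff mu = 0 := by
  rw [← PowerSeries.coeff_zero_eq_constantCoeff_apply, coeff_mu]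
  simp [bernoulliPowerSeries, PowerSeries.coeff_one]
  norm_num

/-- The formal construction of `exp(μ)` is repeated on functions: divide `e^h - 1` by `h`, take the
reciprocal, subtract from `1`, divide by `h`, exponentiate. -/
theorem hasAsymp_expMuFun :
    HasAsymp (𝓝[>] 0) id expMuFun (expMu.map (algebraMap ℚ ℝ)) := by
  have hτ := tendsto_id_nhdsGT_zero
  have hpos : ∀ᶠ h : ℝ in 𝓝[>] 0, 0 < h := eventually_mem_nhdsWithin
  have hexp : ∀ h : ℝ, 0 < h → 0 < Real.exp h - 1 := fun h hh => by
    linarith [Real.add_one_lt_exp hh.ne']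
  set D : ℝ⟦X⟧ := PowerSeries.mk fun k => (((k + 1).factorial : ℝ)⁻¹)
  have hD : PowerSeries.X * D = PowerSeries.exp ℝ - 1 := by
    ext n
    cases n <;> simp [D, PowerSeries.coeff_succ_X_mul, PowerSeries.coeff_exp, PowerSeries.coeff_one]
  have h1 : HasAsymp (𝓝[>] 0) id (fun h : ℝ => (Real.exp h - 1) / h) D := by
    apply HasAsymp.of_X_mul (hpos.mono fun h hh => hh.ne')
    rw [hD]
    have h2 := ((hasAsymp_exp.comp tendsto_id_nhdsGT_zero).sub (hasAsymp_const hτ 1))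
    simp only [map_one] at h2
    refine h2.congr' ?_
    filter_upwards [hpos] with h hh
    simp only [id]
    field_simp
  have hB : (bernoulliPowerSeries ℚ).map (algebraMap ℚ ℝ) * D = 1 := by
    have := congrArg (PowerSeries.map (algebraMap ℚ ℝ)) (bernoulliPowerSeries_mul_exp_sub_one ℚ)
    rw [map_mul, map_sub, PowerSeries.map_exp, map_one, PowerSeries.map_X, ← hD] at this
    apply mul_left_cancel₀ (PowerSeries.X_ne_zero (R := ℝ))
    linear_combination this
  have h2 : HasAsymp (𝓝[>] 0) id (fun h : ℝ => h / (Real.exp h - 1))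
      ((bernoulliPowerSeries ℚ).map (algebraMap ℚ ℝ)) := by
    refine h1.of_mul_eq_one hτ ?_ ?_ hB
    · apply IsBigO.of_bound 1
      filter_upwards [hpos] with h hh
      rw [Real.norm_eq_abs, abs_of_nonneg (div_nonneg hh.le (hexp h hh).le), norm_one, mul_one,
        div_le_one (hexp h hh)]
      linarith [Real.add_one_lt_exp hh.ne']
    · filter_upwards [hpos] with h hh
      have := (hexp h hh).ne'
      field_simp
  have h3 : HasAsymp (𝓝[>] 0) id (fun h : ℝ => h⁻¹ - (Real.exp h - 1)⁻¹)
      ((mu + PowerSeries.C (1 / 2 : ℚ)).map (algebraMap ℚ ℝ)) := by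
    apply HasAsymp.of_X_mul (hpos.mono fun h hh => hh.ne')
    have h4 := (hasAsymp_const hτ 1).sub h2
    have h5 := congrArg (PowerSeries.map (algebraMap ℚ ℝ)) one_sub_bernoulliPowerSeries
    rw [map_sub, map_one, map_mul, PowerSeries.map_X] at h5
    rw [map_one, h5] at h4
    refine h4.congr' ?_
    filter_upwards [hpos] with h hh
    have := (hexp h hh).ne'
    show 1 - h / (Real.exp h - 1) = h * (h⁻¹ - (Real.exp h - 1)⁻¹)
    field_simp
  have h4 : HasAsymp (𝓝[>] 0) id (fun h : ℝ => h⁻¹ - (Real.exp h - 1)⁻¹ - 1 / 2)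
      (mu.map (algebraMap ℚ ℝ)) := by
    convert h3.sub (hasAsymp_const hτ (1 / 2)) using 1
    simp
  have h5 := h4.exp hτ (by
    rw [← PowerSeries.coeff_zero_eq_constantCoeff_apply, PowerSeries.coeff_map,
      PowerSeries.coeff_zero_eq_constantCoeff_apply, constantCoeff_mu, map_zero])
  have h6 : expMu.map (algebraMap ℚ ℝ)
      = (PowerSeries.exp ℝ).subst (mu.map (algebraMap ℚ ℝ)) := by
    rw [expMu, ← PowerSeries.map_exp (algebraMap ℚ ℝ)]
    exact PowerSeries.map_subst hasSubst_mu _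
  rw [h6]
  exact h5

theorem expMuFun_bound (N : ℕ) : ∃ C, 0 ≤ C ∧ ∀ y, 0 < y →
    |expMuFun y - (PowerSeries.trunc (N + 1) (expMu.map (algebraMap ℚ ℝ))).eval y|
      ≤ C * y ^ (N + 1) := by
  refine hasAsymp_expMuFun.exists_bound (fun δ hδ => ⟨Real.exp δ⁻¹, fun y hy => ?_⟩) N
  have hy0 : 0 < y := hδ.trans_le hy
  have h1 : 0 < (Real.exp y - 1)⁻¹ := by
    have := Real.add_one_lt_exp hy0.ne'
    apply inv_pos.2
    linarith
  have h2 : y⁻¹ ≤ δ⁻¹ := inv_anti₀ hδ hy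
  rw [expMuFun, abs_of_pos (Real.exp_pos _)]
  calc Real.exp (y⁻¹ - (Real.exp y - 1)⁻¹ - 1 / 2) ≤ Real.exp δ⁻¹ * 1 := by
        rw [mul_one]; apply Real.exp_le_exp.2; linarith
    _ ≤ _ := by gcongr; linarith

/-! ### Gaussian moments and Watson's lemma. -/

theorem tendsto_inv_atTop_zero_real : Tendsto (fun r : ℝ => r⁻¹) atTop (𝓝 0) :=
  tendsto_inv_atTop_zero

theorem Gamma_nat_add_half (j : ℕ) :
    Real.Gamma (j + 1 / 2) = (ascPochhammer ℝ j).eval (1 / 2) * √Real.pi := by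
  induction j with
  | zero => simpa using Real.Gamma_one_half_eq
  | succ j ih =>
    have : ((j + 1 : ℕ) : ℝ) + 1 / 2 = (j + 1 / 2) + 1 := by push_cast; ring
    rw [this, Real.Gamma_add_one (by positivity), ih, ascPochhammer_succ_eval]
    ring

theorem integrable_pow_mul_exp_neg_mul_sq {b : ℝ} (hb : 0 < b) (j : ℕ) :
    Integrable fun x : ℝ => x ^ j * Real.exp (-b * x ^ 2) := by
  have := integrable_rpow_mul_exp_neg_mul_sq hb (s := j) (by linarith [j.cast_nonneg (α := ℝ)])
  simpa only [Real.rpow_natCast] using this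

theorem integral_pow_two_mul_mul_exp {b : ℝ} (hb : 0 < b) (j : ℕ) :
    ∫ x : ℝ, x ^ (2 * j) * Real.exp (-b * x ^ 2)
      = √(Real.pi / b) * ((ascPochhammer ℝ j).eval (1 / 2) * b⁻¹ ^ j) := by
  have h1 : ∫ x : ℝ, x ^ (2 * j) * Real.exp (-b * x ^ 2)
      = 2 * ∫ x in Set.Ioi (0 : ℝ), x ^ (2 * j) * Real.exp (-b * x ^ 2) := by
    rw [← integral_comp_abs (f := fun x => x ^ (2 * j) * Real.exp (-b * x ^ 2))]
    simp [pow_mul]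
  have h2 := integral_rpow_mul_exp_neg_mul_rpow (p := 2) (q := (2 * j : ℕ)) (b := b) two_pos
    (by linarith [(2 * j).cast_nonneg (α := ℝ)]) hb
  have h3 : (((2 * j : ℕ) : ℝ) + 1) / 2 = j + 1 / 2 := by push_cast; ring
  rw [neg_div, h3, Gamma_nat_add_half] at h2
  simp only [Real.rpow_natCast, Real.rpow_two] at h2
  rw [h1, h2, Real.rpow_neg hb.le, Real.rpow_add hb, Real.rpow_natCast, ← Real.sqrt_eq_rpow,
    Real.sqrt_div Real.pi_pos.le, inv_pow]
  have : 0 < √b := Real.sqrt_pos.2 hb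
  field_simp

/-- Watson's lemma for Gaussian integrals of an even function. -/
theorem hasAsymp_gaussian {g : ℝ → ℝ} {G : ℝ⟦X⟧} (hc : Continuous fun x : ℝ => g (x ^ 2))
    (hg : HasAsymp (𝓝[>] 0) id g G)
    (hgrow : ∀ δ > 0, ∃ A, ∀ y, δ ≤ y → |g y| ≤ A * (1 + y)) :
    HasAsymp atTop (fun r : ℝ => r⁻¹)
      (fun r => √(r / Real.pi) * ∫ x : ℝ, 2 * (g (x ^ 2) * Real.exp (-(4 * r) * x ^ 2)))
      (PowerSeries.mk fun j => PowerSeries.coeff j G *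
        ((ascPochhammer ℝ j).eval (1 / 2) * (1 / 4) ^ j)) := by
  refine HasAsymp.of_succ tendsto_inv_atTop_zero_real fun N => ?_
  obtain ⟨C, hC0, hC⟩ := hg.exists_bound hgrow N
  set T := PowerSeries.trunc (N + 1) G with hT
  apply IsBigO.of_bound (C * ((ascPochhammer ℝ (N + 1)).eval (1 / 2) * (1 / 4) ^ (N + 1)))
  filter_upwards [eventually_gt_atTop 0] with r hr
  have h4r : 0 < 4 * r := by positivity
  -- The prefactor gives the weight `2 e^{-4 r x²}` total mass one, so its moments are `(1/2)_j
  -- (4r)^{-j}`.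
  have hnorm : √(r / Real.pi) * (2 * √(Real.pi / (4 * r))) = 1 := by
    have : (2 : ℝ) = √4 := by rw [show (4 : ℝ) = 2 ^ 2 by norm_num]; simp
    rw [this, ← Real.sqrt_mul (by norm_num), ← Real.sqrt_mul (by positivity)]
    rw [Real.sqrt_eq_one]
    have := Real.pi_pos
    field_simp
  have hmom : ∀ j : ℕ, √(r / Real.pi) * ∫ x : ℝ, 2 * (x ^ (2 * j) * Real.exp (-(4 * r) * x ^ 2))
      = (ascPochhammer ℝ j).eval (1 / 2) * (1 / 4) ^ j * r⁻¹ ^ j := fun j => by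
    rw [integral_const_mul, integral_pow_two_mul_mul_exp h4r, ← mul_assoc, ← mul_assoc,
      mul_assoc (√(r / Real.pi)), hnorm, mul_inv, mul_pow]
    ring
  have hTint : ∀ k : ℕ, Integrable fun x : ℝ => PowerSeries.coeff k G *
      (2 * (x ^ (2 * k) * Real.exp (-(4 * r) * x ^ 2))) := fun k =>
    ((integrable_pow_mul_exp_neg_mul_sq h4r _).const_mul 2).const_mul _
  have hTeq : ∀ x : ℝ, 2 * (T.eval (x ^ 2) * Real.exp (-(4 * r) * x ^ 2)) =
      ∑ k ∈ Finset.range (N + 1), PowerSeries.coeff k G *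
      (2 * (x ^ (2 * k) * Real.exp (-(4 * r) * x ^ 2))) := fun x => by
    rw [hT, eval_trunc, Finset.sum_mul, Finset.mul_sum]
    refine Finset.sum_congr rfl fun k _ => ?_
    rw [pow_mul]
    ring
  have hTI : Integrable fun x : ℝ => 2 * (T.eval (x ^ 2) * Real.exp (-(4 * r) * x ^ 2)) := by
    simp_rw [hTeq]
    exact integrable_finsetSum _ fun k _ => hTint k
  have hbd : ∀ᵐ x : ℝ, ‖2 * ((g (x ^ 2) - T.eval (x ^ 2)) * Real.exp (-(4 * r) * x ^ 2))‖
      ≤ C * (2 * (x ^ (2 * (N + 1)) * Real.exp (-(4 * r) * x ^ 2))) := by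
    have : ∀ᵐ x : ℝ, x ≠ 0 := by simp [ae_iff]
    filter_upwards [this] with x hx
    have h1 := hC (x ^ 2) (by positivity)
    rw [norm_mul, norm_mul, Real.norm_eq_abs, Real.norm_eq_abs, Real.norm_eq_abs, Real.abs_exp,
      abs_two]
    calc 2 * (|g (x ^ 2) - T.eval (x ^ 2)| * Real.exp (-(4 * r) * x ^ 2))
        ≤ 2 * ((C * (x ^ 2) ^ (N + 1)) * Real.exp (-(4 * r) * x ^ 2)) := by gcongr
      _ = _ := by rw [pow_mul]; ring
  have hBI := ((integrable_pow_mul_exp_neg_mul_sq h4r (2 * (N + 1))).const_mul 2).const_mul C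
  have hdI : Integrable fun x : ℝ =>
      2 * ((g (x ^ 2) - T.eval (x ^ 2)) * Real.exp (-(4 * r) * x ^ 2)) :=
    hBI.mono' (by
      have : Continuous fun x : ℝ => T.eval (x ^ 2) := T.continuous.comp (by fun_prop)
      exact (((hc.sub this).mul (by fun_prop)).const_mul 2).aestronglyMeasurable) hbd
  have hsplit : ∫ x : ℝ, 2 * (g (x ^ 2) * Real.exp (-(4 * r) * x ^ 2)) =
      (∫ x : ℝ, 2 * ((g (x ^ 2) - T.eval (x ^ 2)) * Real.exp (-(4 * r) * x ^ 2))) +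
      ∫ x : ℝ, 2 * (T.eval (x ^ 2) * Real.exp (-(4 * r) * x ^ 2)) := by
    rw [← integral_add hdI hTI]
    congr 1
    ext x
    ring
  have hTval : √(r / Real.pi) * ∫ x : ℝ, 2 * (T.eval (x ^ 2) * Real.exp (-(4 * r) * x ^ 2)) =
      (PowerSeries.trunc (N + 1) (PowerSeries.mk fun j => PowerSeries.coeff j G *
        ((ascPochhammer ℝ j).eval (1 / 2) * (1 / 4) ^ j))).eval r⁻¹ := by
    simp_rw [hTeq]
    rw [integral_finsetSum _ fun k _ => hTint k, eval_trunc, Finset.mul_sum]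
    refine Finset.sum_congr rfl fun k _ => ?_
    rw [integral_const_mul, mul_left_comm, hmom, PowerSeries.coeff_mk]
    ring
  rw [hsplit, mul_add, hTval, add_sub_cancel_right, norm_mul, Real.norm_eq_abs,
    abs_of_nonneg (Real.sqrt_nonneg _), Real.norm_eq_abs (r⁻¹ ^ (N + 1)),
    abs_of_pos (by positivity)]
  calc √(r / Real.pi) * ‖∫ x : ℝ, 2 * ((g (x ^ 2) - T.eval (x ^ 2)) *
        Real.exp (-(4 * r) * x ^ 2))‖
      ≤ √(r / Real.pi) * ∫ x : ℝ, C * (2 * (x ^ (2 * (N + 1)) * Real.exp (-(4 * r) * x ^ 2))) := by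
        gcongr
        exact norm_integral_le_of_norm_le hBI hbd
    _ = _ := by
        rw [integral_const_mul, mul_left_comm, hmom]
        ring

/-! ### Macdonald functions and their expansions. -/

/-- The scaled Macdonald function `2 e^{2r} K_ν(2r)`, as an integral over the real line. -/
noncomputable def macdonald (ν r : ℝ) : ℝ :=
  ∫ φ : ℝ, Real.exp (ν * φ) * Real.exp (-r * (2 * Real.cosh φ - 2))

theorem two_cosh_sub_two (φ : ℝ) : 2 * Real.cosh φ - 2 = 4 * Real.sinh (φ / 2) ^ 2 := by
  have h := Real.cosh_two_mul (φ / 2)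
  rw [mul_div_cancel₀ φ two_ne_zero, Real.cosh_sq'] at h
  rw [h]
  ring

theorem sq_le_two_cosh_sub_two (φ : ℝ) : φ ^ 2 ≤ 2 * Real.cosh φ - 2 := by
  rw [two_cosh_sub_two, ← sq_abs φ, ← sq_abs (Real.sinh (φ / 2)), Real.abs_sinh, abs_div, abs_two]
  have h : |φ| / 2 ≤ Real.sinh (|φ| / 2) := Real.self_le_sinh_iff.2 (by positivity)
  have h0 : 0 ≤ |φ| / 2 := by positivity
  nlinarith

/-- Combine `φ² ≤ 2 cosh φ - 2` with completion of the square. The Gaussian majorant yields both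
integrability and vanishing boundary terms. -/
theorem exp_mul_exp_cosh_le {r : ℝ} (hr : 0 < r) (ν φ : ℝ) :
    Real.exp (ν * φ) * Real.exp (-r * (2 * Real.cosh φ - 2))
      ≤ Real.exp (ν ^ 2 / (2 * r)) * Real.exp (-(r / 2) * φ ^ 2) := by
  rw [← Real.exp_add, ← Real.exp_add, Real.exp_le_exp]
  have h1 := mul_le_mul_of_nonneg_left (sq_le_two_cosh_sub_two φ) hr.le
  have h2 : ν * φ ≤ ν ^ 2 / (2 * r) + r / 2 * φ ^ 2 := by
    have : ν ^ 2 / (2 * r) + r / 2 * φ ^ 2 - ν * φ = (ν - r * φ) ^ 2 / (2 * r) := by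
      field_simp
      ring
    have h3 : 0 ≤ (ν - r * φ) ^ 2 / (2 * r) := by positivity
    linarith
  linarith

theorem integrable_macdonald {r : ℝ} (hr : 0 < r) (ν : ℝ) :
    Integrable fun φ : ℝ => Real.exp (ν * φ) * Real.exp (-r * (2 * Real.cosh φ - 2)) := by
  refine ((integrable_exp_neg_mul_sq (half_pos hr)).const_mul (Real.exp (ν ^ 2 / (2 * r)))).mono'
    (Continuous.aestronglyMeasurable (by fun_prop)) (ae_of_all _ fun φ => ?_)
  rw [Real.norm_eq_abs, abs_of_pos (by positivity)]
  exact exp_mul_exp_cosh_le hr ν φ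

theorem tendsto_exp_mul_exp_cosh {r : ℝ} (hr : 0 < r) (ν : ℝ) {l : Filter ℝ}
    (hl : Tendsto (fun φ : ℝ => φ ^ 2) l atTop) :
    Tendsto (fun φ : ℝ => Real.exp (ν * φ) * Real.exp (-r * (2 * Real.cosh φ - 2))) l (𝓝 0) := by
  have h : Tendsto (fun φ : ℝ => Real.exp (ν ^ 2 / (2 * r)) * Real.exp (-(r / 2) * φ ^ 2)) l
      (𝓝 (Real.exp (ν ^ 2 / (2 * r)) * 0)) := by
    refine Tendsto.const_mul _ (Real.tendsto_exp_atBot.comp ?_)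
    exact hl.const_mul_atTop_of_neg (by linarith)
  rw [mul_zero] at h
  exact squeeze_zero (fun φ => by positivity) (exp_mul_exp_cosh_le hr ν) h

/-- The derivative of the integrand of order `ν` integrates to zero over the line; writing `2 sinh φ
= e^φ - e^{-φ}` produces the orders `ν ± 1`. -/
theorem macdonald_recurrence {r : ℝ} (hr : 0 < r) (ν : ℝ) :
    macdonald (ν + 1) r = ν * (r⁻¹ * macdonald ν r) + macdonald (ν - 1) r := by
  have hd : ∀ φ : ℝ, HasDerivAt
      (fun φ : ℝ => Real.exp (ν * φ) * Real.exp (-r * (2 * Real.cosh φ - 2)))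
      (ν * (Real.exp (ν * φ) * Real.exp (-r * (2 * Real.cosh φ - 2)))
        - r * (Real.exp ((ν + 1) * φ) * Real.exp (-r * (2 * Real.cosh φ - 2)))
        + r * (Real.exp ((ν - 1) * φ) * Real.exp (-r * (2 * Real.cosh φ - 2)))) φ := fun φ => by
    have h1 : HasDerivAt (fun φ : ℝ => Real.exp (ν * φ)) (Real.exp (ν * φ) * ν) φ := by
      simpa using ((hasDerivAt_id φ).const_mul ν).exp
    have h2 : HasDerivAt (fun φ : ℝ => Real.exp (-r * (2 * Real.cosh φ - 2)))
        (Real.exp (-r * (2 * Real.cosh φ - 2)) * (-r * (2 * Real.sinh φ))) φ :=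
      ((((Real.hasDerivAt_cosh φ).const_mul 2).sub_const 2).const_mul (-r)).exp
    refine (h1.mul h2).congr_deriv ?_
    have e1 : Real.exp ((ν + 1) * φ) = Real.exp (ν * φ) * Real.exp φ := by
      rw [← Real.exp_add]; ring_nf
    have e2 : Real.exp ((ν - 1) * φ) = Real.exp (ν * φ) * Real.exp (-φ) := by
      rw [← Real.exp_add]; ring_nf
    rw [e1, e2, Real.sinh_eq]
    ring
  have i0 := (integrable_macdonald hr ν).const_mul ν
  have i1 := (integrable_macdonald hr (ν + 1)).const_mul r
  have i2 := (integrable_macdonald hr (ν - 1)).const_mul r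
  have h := integral_of_hasDerivAt_of_tendsto hd ((i0.sub i1).add i2)
    (tendsto_exp_mul_exp_cosh hr ν (by
      simpa [Function.comp_def] using
        (tendsto_pow_atTop (α := ℝ) two_ne_zero).comp tendsto_abs_atBot_atTop))
    (tendsto_exp_mul_exp_cosh hr ν (tendsto_pow_atTop two_ne_zero))
  have h' := integral_add (i0.sub i1) i2
  have h'' := integral_sub i0 i1
  simp only [Pi.sub_apply] at h h' h''
  rw [h', h'', integral_const_mul, integral_const_mul, integral_const_mul] at h
  change ν * macdonald ν r - r * macdonald (ν + 1) r + r * macdonald (ν - 1) r = 0 - 0 at h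
  field_simp
  linarith

/-- Substitution `φ = 2 arsinh x`, which makes the exponent exactly quadratic: `2 cosh φ - 2 = 4
x²`. -/
theorem integral_sinh_half_sq (g : ℝ → ℝ) (r : ℝ) :
    ∫ φ : ℝ, g (Real.sinh (φ / 2) ^ 2) * Real.exp (-r * (2 * Real.cosh φ - 2)) =
      ∫ x : ℝ, 2 * ((√(1 + x ^ 2))⁻¹ * g (x ^ 2) * Real.exp (-(4 * r) * x ^ 2)) := by
  have himg : (fun x => 2 * Real.arsinh x) '' Set.univ = Set.univ := by
    rw [Set.image_univ]
    refine Set.range_eq_univ.2 fun y => ⟨Real.sinh (y / 2), ?_⟩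
    simp only [Real.arsinh_sinh]
    ring
  have h := integral_image_eq_integral_abs_deriv_smul (s := Set.univ)
    (f := fun x => 2 * Real.arsinh x) (f' := fun x => 2 * (√(1 + x ^ 2))⁻¹) MeasurableSet.univ
    (fun x _ => ((Real.hasDerivAt_arsinh x).const_mul 2).hasDerivWithinAt)
    (fun x _ y _ hxy => Real.arsinh_injective (by simpa using hxy))
    (fun φ => g (Real.sinh (φ / 2) ^ 2) * Real.exp (-r * (2 * Real.cosh φ - 2)))
  rw [himg, Measure.restrict_univ] at h
  rw [h]
  congr 1
  ext x
  rw [two_cosh_sub_two, mul_div_cancel_left₀ _ two_ne_zero, Real.sinh_arsinh,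
    abs_of_pos (by positivity), smul_eq_mul]
  ring_nf

theorem macdonald_zero (r : ℝ) : macdonald 0 r =
    ∫ x : ℝ, 2 * ((√(1 + x ^ 2))⁻¹ * Real.exp (-(4 * r) * x ^ 2)) := by
  simpa [macdonald] using integral_sinh_half_sq (fun _ => 1) r

/-- Averaging over `φ ↦ -φ` replaces `e^φ` by `cosh φ = 1 + 2 sinh²(φ/2)`, a function of `x²`. -/
theorem macdonald_one {r : ℝ} (hr : 0 < r) : macdonald 1 r =
    ∫ x : ℝ, 2 * ((1 + 2 * x ^ 2) * (√(1 + x ^ 2))⁻¹ * Real.exp (-(4 * r) * x ^ 2)) := by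
  have h1 : macdonald (-1) r = macdonald 1 r := by
    rw [macdonald, ← integral_neg_eq_self]
    simp [macdonald]
  have h2 : macdonald 1 r =
      ∫ φ : ℝ, (1 + 2 * Real.sinh (φ / 2) ^ 2) * Real.exp (-r * (2 * Real.cosh φ - 2)) := by
    have h3 := integral_add (integrable_macdonald hr 1) (integrable_macdonald hr (-1))
    change _ = macdonald 1 r + macdonald (-1) r at h3
    rw [h1, ← two_mul] at h3
    rw [← mul_left_cancel_iff_of_pos (two_pos (α := ℝ)), ← h3, ← integral_const_mul]
    congr 1
    ext φ
    have h4 := two_cosh_sub_two φ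
    have h5 : Real.exp φ + Real.exp (-φ) = 2 * (1 + 2 * Real.sinh (φ / 2) ^ 2) := by
      rw [Real.cosh_eq] at h4
      linarith
    rw [one_mul, neg_one_mul, ← add_mul, h5]
    ring
  rw [h2, integral_sinh_half_sq (fun y => 1 + 2 * y)]
  congr 1
  ext x
  ring

/-- The coefficients `(ν + 1/2 - j)_{2j} / (4^j j!)` of the expansion of the Macdonald function. -/
noncomputable def macdonaldCoeff (ν : ℝ) (j : ℕ) : ℝ :=
  (ascPochhammer ℝ (2 * j)).eval (ν + 1 / 2 - j) / (4 ^ j * j.factorial)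

theorem ascPochhammer_eval_succ_left (n : ℕ) (x : ℝ) :
    (ascPochhammer ℝ (n + 1)).eval x = x * (ascPochhammer ℝ n).eval (x + 1) := by
  simp [ascPochhammer_succ_left]

theorem macdonaldCoeff_zero_right (ν : ℝ) : macdonaldCoeff ν 0 = 1 := by
  simp [macdonaldCoeff]

/-- The formal counterpart of `macdonald_recurrence`. All three Pochhammer products contain the
block `(ν + 1/2 - j)_{2j}`; only the outer factors differ. -/
theorem macdonaldCoeff_recurrence (ν : ℝ) (j : ℕ) : macdonaldCoeff (ν + 1) (j + 1) =
    ν * macdonaldCoeff ν j + macdonaldCoeff (ν - 1) (j + 1) := by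
  have e1 : ν + 1 + 1 / 2 - ((j + 1 : ℕ) : ℝ) = ν + 1 / 2 - j := by push_cast; ring
  have e2 : ν - 1 + 1 / 2 - ((j + 1 : ℕ) : ℝ) = ν + 1 / 2 - j - 2 := by push_cast; ring
  have e3 : ν + 1 / 2 - j - 2 + 1 + 1 = ν + 1 / 2 - (j : ℝ) := by ring
  rw [macdonaldCoeff, macdonaldCoeff, macdonaldCoeff, e1, e2,
    show 2 * (j + 1) = 2 * j + 1 + 1 by ring,
    ascPochhammer_eval_succ_left (2 * j + 1) (_ - 2), ascPochhammer_eval_succ_left (2 * j), e3,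
    ascPochhammer_succ_eval, ascPochhammer_succ_eval, Nat.factorial_succ]
  push_cast
  field_simp
  ring

theorem choose_neg_half_succ (j : ℕ) : ((j : ℝ) + 1) * Ring.choose (-1 / 2 : ℝ) (j + 1) =
    (-1 / 2 - j) * Ring.choose (-1 / 2 : ℝ) j := by
  have h1 := Ring.descPochhammer_eq_factorial_smul_choose (-1 / 2 : ℝ) j
  have h2 := Ring.descPochhammer_eq_factorial_smul_choose (-1 / 2 : ℝ) (j + 1)
  rw [descPochhammer_succ_right, Polynomial.smeval_mul, h1] at h2
  simp only [nsmul_eq_mul, Nat.factorial_succ, Nat.cast_mul, Nat.cast_add, Nat.cast_one,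
    Polynomial.smeval_sub, Polynomial.smeval_X, Polynomial.smeval_natCast, pow_one, pow_zero,
    mul_one] at h2
  have : (j.factorial : ℝ) ≠ 0 := by positivity
  apply mul_left_cancel₀ this
  linear_combination -h2

/-- The product splits at its middle: the lower half is the falling factorial of `-1/2`, the upper
half is `(1/2)_j`. -/
theorem ascPochhammer_half_sub (j : ℕ) : (ascPochhammer ℝ (2 * j)).eval (1 / 2 - (j : ℝ)) =
    j.factorial * Ring.choose (-1 / 2 : ℝ) j * (ascPochhammer ℝ j).eval (1 / 2) := by
  induction j with
  | zero => simp
  | succ j ih =>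
    have e : 1 / 2 - ((j + 1 : ℕ) : ℝ) + 1 = 1 / 2 - j := by push_cast; ring
    rw [show 2 * (j + 1) = 2 * j + 1 + 1 by ring, ascPochhammer_eval_succ_left, e,
      ascPochhammer_succ_eval, ih, ascPochhammer_succ_eval, Nat.factorial_succ]
    push_cast
    linear_combination (-(j.factorial * (ascPochhammer ℝ j).eval (1 / 2) * (1 / 2 + j)) : ℝ) *
      choose_neg_half_succ j

theorem macdonaldCoeff_zero_left (j : ℕ) : macdonaldCoeff 0 j =
    Ring.choose (-1 / 2 : ℝ) j * ((ascPochhammer ℝ j).eval (1 / 2) * (1 / 4) ^ j) := by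
  rw [macdonaldCoeff, zero_add, ascPochhammer_half_sub, one_div_pow]
  field_simp

/-- The bracket is the coefficient of `y^{j+1}` in `(1 + 2y)(1 + y)^{-1/2}`, the remaining factor a
Gaussian moment. -/
theorem macdonaldCoeff_one_left (j : ℕ) : macdonaldCoeff 1 (j + 1) =
    (Ring.choose (-1 / 2 : ℝ) (j + 1) + 2 * Ring.choose (-1 / 2 : ℝ) j) *
      ((ascPochhammer ℝ (j + 1)).eval (1 / 2) * (1 / 4) ^ (j + 1)) := by
  have e : 1 + 1 / 2 - ((j + 1 : ℕ) : ℝ) = 1 / 2 - j := by push_cast; ring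
  have h : Ring.choose (-1 / 2 : ℝ) (j + 1) =
      (-1 / 2 - j) * Ring.choose (-1 / 2 : ℝ) j / ((j : ℝ) + 1) := by
    rw [← choose_neg_half_succ]
    field_simp
  rw [macdonaldCoeff, e, show 2 * (j + 1) = 2 * j + 1 + 1 by ring, ascPochhammer_succ_eval,
    ascPochhammer_succ_eval, ascPochhammer_half_sub, ascPochhammer_succ_eval, h, one_div_pow,
    Nat.factorial_succ]
  push_cast
  field_simp
  ring

theorem hasAsymp_inv_sqrt_one_add : HasAsymp (𝓝[>] 0) id (fun y : ℝ => (√(1 + y))⁻¹)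
    (PowerSeries.mk fun j => Ring.choose (-1 / 2 : ℝ) j) := by
  have h := (hasAsymp_of_hasFPowerSeriesAt
    (Real.one_add_rpow_hasFPowerSeriesAt_zero (a := -1 / 2))).comp tendsto_id_nhdsGT_zero
  refine h.congr' ?_
  filter_upwards [eventually_mem_nhdsWithin] with y hy
  have hy : 0 < y := hy
  simp only [id]
  rw [Real.sqrt_eq_rpow, ← Real.rpow_neg (by linarith)]
  norm_num

theorem inv_sqrt_one_add_le {y : ℝ} (hy : 0 ≤ y) : |(√(1 + y))⁻¹| ≤ 1 := by
  rw [abs_of_nonneg (by positivity)]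
  apply inv_le_one_of_one_le₀
  rw [Real.one_le_sqrt]
  linarith

theorem hasAsymp_macdonald_zero : HasAsymp atTop (fun r : ℝ => r⁻¹)
    (fun r => √(r / Real.pi) * macdonald 0 r) (PowerSeries.mk (macdonaldCoeff 0)) := by
  have h := hasAsymp_gaussian (g := fun y => (√(1 + y))⁻¹)
    (Continuous.inv₀ (by fun_prop) fun x => by positivity) hasAsymp_inv_sqrt_one_add
    (fun δ hδ => ⟨1, fun y hy => by
      have := inv_sqrt_one_add_le (hδ.le.trans hy)
      linarith⟩)
  simp only [← macdonald_zero] at h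
  convert h using 2
  ext j
  rw [PowerSeries.coeff_mk, macdonaldCoeff_zero_left]

theorem hasAsymp_macdonald_one : HasAsymp atTop (fun r : ℝ => r⁻¹)
    (fun r => √(r / Real.pi) * macdonald 1 r) (PowerSeries.mk (macdonaldCoeff 1)) := by
  have h0 : HasAsymp (𝓝[>] 0) id (fun y : ℝ => (1 + 2 * y) * (√(1 + y))⁻¹)
      ((PowerSeries.C 1 + PowerSeries.C 2 * PowerSeries.X) *
        PowerSeries.mk fun j => Ring.choose (-1 / 2 : ℝ) j) :=
    ((hasAsymp_const tendsto_id_nhdsGT_zero 1).add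
      ((hasAsymp_self tendsto_id_nhdsGT_zero).const_mul 2)).mul tendsto_id_nhdsGT_zero
      hasAsymp_inv_sqrt_one_add
  have h := hasAsymp_gaussian (g := fun y => (1 + 2 * y) * (√(1 + y))⁻¹)
    (Continuous.mul (by fun_prop) (Continuous.inv₀ (by fun_prop) fun x => by positivity)) h0
    (fun δ hδ => ⟨2, fun y hy => by
      have hy0 := hδ.le.trans hy
      have h1 := inv_sqrt_one_add_le hy0
      rw [abs_mul, abs_of_nonneg (by positivity : 0 ≤ 1 + 2 * y)]
      calc (1 + 2 * y) * |(√(1 + y))⁻¹| ≤ (1 + 2 * y) * 1 := by gcongr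
        _ ≤ _ := by linarith⟩)
  have h2 : PowerSeries.mk (macdonaldCoeff 1) = PowerSeries.mk fun j => PowerSeries.coeff j
      ((PowerSeries.C 1 + PowerSeries.C 2 * PowerSeries.X) *
        PowerSeries.mk fun j => Ring.choose (-1 / 2 : ℝ) j) *
        ((ascPochhammer ℝ j).eval (1 / 2) * (1 / 4) ^ j) := by
    ext j
    rw [PowerSeries.coeff_mk, PowerSeries.coeff_mk]
    cases j with
    | zero => simp [macdonaldCoeff_zero_right]
    | succ j =>
      rw [macdonaldCoeff_one_left, add_mul (PowerSeries.C 1), mul_assoc (PowerSeries.C 2), map_add,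
        PowerSeries.coeff_C_mul, PowerSeries.coeff_C_mul, PowerSeries.coeff_succ_X_mul]
      simp
  rw [h2]
  refine h.congr' ?_
  filter_upwards [eventually_gt_atTop 0] with r hr
  rw [macdonald_one hr]

/-- The asymptotic expansion of the Macdonald functions of natural order. -/
theorem hasAsymp_macdonald (ν : ℕ) : HasAsymp atTop (fun r : ℝ => r⁻¹)
    (fun r => √(r / Real.pi) * macdonald ν r) (PowerSeries.mk (macdonaldCoeff ν)) := by
  induction ν using Nat.twoStepInduction with
  | zero => simpa using hasAsymp_macdonald_zero
  | one => simpa using hasAsymp_macdonald_one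
  | more ν h0 h1 =>
    -- The recurrence carries the expansion from the orders `ν` and `ν + 1` to `ν + 2`, so Watson's
    -- lemma is needed only in orders 0 and 1.
    have h := (((hasAsymp_self tendsto_inv_atTop_zero_real).mul tendsto_inv_atTop_zero_real
      h1).const_mul ((ν : ℝ) + 1)).add h0
    have h2 : PowerSeries.mk (macdonaldCoeff ((ν + 2 : ℕ) : ℝ)) =
        PowerSeries.C ((ν : ℝ) + 1) * (PowerSeries.X * PowerSeries.mk (macdonaldCoeff (ν + 1 : ℕ)))
          + PowerSeries.mk (macdonaldCoeff ν) := by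
      ext j
      cases j with
      | zero => simp [macdonaldCoeff_zero_right]
      | succ j =>
        have h3 := macdonaldCoeff_recurrence ((ν : ℝ) + 1) j
        rw [add_sub_cancel_right] at h3
        rw [map_add, PowerSeries.coeff_C_mul, PowerSeries.coeff_succ_X_mul, PowerSeries.coeff_mk,
          PowerSeries.coeff_mk, PowerSeries.coeff_mk]
        push_cast
        rw [← h3]
        ring_nf
    rw [h2]
    refine h.congr' ?_
    filter_upwards [eventually_gt_atTop 0] with r hr
    have h3 := macdonald_recurrence hr ((ν : ℝ) + 1)
    rw [add_sub_cancel_right] at h3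
    have e : (((ν + 2 : ℕ) : ℝ)) = (ν : ℝ) + 1 + 1 := by push_cast; ring
    rw [e, h3]
    push_cast
    ring

/-! ### Expansion of the Laplace integral of exp(μ). -/

theorem image_exp_div {r : ℝ} (hr : 0 < r) :
    (fun φ : ℝ => Real.exp φ / r) '' Set.univ = Set.Ioi 0 := by
  ext h
  simp only [Set.image_univ, Set.mem_range, Set.mem_Ioi]
  constructor
  · rintro ⟨φ, rfl⟩
    positivity
  · intro hh
    refine ⟨Real.log (h * r), ?_⟩
    rw [Real.exp_log (by positivity)]
    field_simp

theorem hasDerivWithinAt_exp_div (r : ℝ) (φ : ℝ) (s : Set ℝ) :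
    HasDerivWithinAt (fun φ : ℝ => Real.exp φ / r) (Real.exp φ / r) s φ :=
  ((Real.hasDerivAt_exp φ).div_const r).hasDerivWithinAt

theorem injOn_exp_div {r : ℝ} (hr : 0 < r) :
    Set.InjOn (fun φ : ℝ => Real.exp φ / r) Set.univ := fun x _ y _ hxy => by
  simpa [hr.ne'] using hxy

/-- Putting `h = e^φ / r` balances the two terms of the exponent, with minimum value `2r`; the
Jacobian raises the order from `j` to `j + 1`. -/
theorem exp_div_smul_pow_mul_exp {r : ℝ} (hr : 0 < r) (j : ℕ) (φ : ℝ) :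
    |Real.exp φ / r| • ((Real.exp φ / r) ^ j *
        Real.exp (-(Real.exp φ / r)⁻¹ - r ^ 2 * (Real.exp φ / r))) =
      r⁻¹ ^ (j + 1) * Real.exp (-(2 * r)) *
        (Real.exp (((j + 1 : ℕ) : ℝ) * φ) * Real.exp (-r * (2 * Real.cosh φ - 2))) := by
  have e1 : -(Real.exp φ / r)⁻¹ - r ^ 2 * (Real.exp φ / r) =
      -(2 * r) + -r * (2 * Real.cosh φ - 2) := by
    rw [inv_div, Real.cosh_eq, Real.exp_neg]
    field_simp
    ring
  rw [abs_of_pos (by positivity), smul_eq_mul, e1, Real.exp_add, Real.exp_nat_mul, ← mul_assoc,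
    ← pow_succ', div_pow, inv_pow]
  ring

theorem integrableOn_pow_mul_exp {r : ℝ} (hr : 0 < r) (j : ℕ) :
    IntegrableOn (fun h : ℝ => h ^ j * Real.exp (-h⁻¹ - r ^ 2 * h)) (Set.Ioi 0) := by
  rw [← image_exp_div hr, integrableOn_image_iff_integrableOn_abs_deriv_smul MeasurableSet.univ
    (fun φ _ => hasDerivWithinAt_exp_div r φ _) (injOn_exp_div hr), integrableOn_univ]
  simp_rw [exp_div_smul_pow_mul_exp hr]
  exact (integrable_macdonald hr _).const_mul _

theorem integral_pow_mul_exp {r : ℝ} (hr : 0 < r) (j : ℕ) :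
    ∫ h in Set.Ioi 0, h ^ j * Real.exp (-h⁻¹ - r ^ 2 * h) =
      r⁻¹ ^ (j + 1) * Real.exp (-(2 * r)) * macdonald (j + 1 : ℕ) r := by
  rw [← image_exp_div hr, integral_image_eq_integral_abs_deriv_smul MeasurableSet.univ
    (fun φ _ => hasDerivWithinAt_exp_div r φ _) (injOn_exp_div hr), Measure.restrict_univ]
  simp_rw [exp_div_smul_pow_mul_exp hr]
  rw [integral_const_mul, macdonald]

/-- The Laplace type integral that governs the coefficients of `f₁`. -/
noncomputable def expMuInt (r : ℝ) : ℝ :=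
  ∫ h in Set.Ioi 0, expMuFun h * Real.exp (-h⁻¹ - r ^ 2 * h)

/-- The power series `∑ (-1)^m c_m X^m`. -/
noncomputable def cSeries : ℝ⟦X⟧ := PowerSeries.mk fun m => ((-1) ^ m * c m : ℚ)

/-- Reversing the sum shows where `c_m` comes from: the term `h^j` of `exp(μ)` contributes `r^{-j}`
times the Macdonald expansion of order `j + 1`. -/
theorem coeff_cSeries (m : ℕ) : PowerSeries.coeff m cSeries =
    ∑ j ∈ Finset.range (m + 1), ((PowerSeries.coeff j expMu : ℚ) : ℝ) *
      macdonaldCoeff (j + 1 : ℕ) (m - j) := by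
  rw [cSeries, PowerSeries.coeff_mk, c, ← mul_assoc, ← mul_pow, neg_one_mul, neg_neg, one_pow,
    one_mul, ← Finset.sum_range_reflect]
  push_cast
  refine Finset.sum_congr rfl fun j hj => ?_
  have hj : j ≤ m := Nat.lt_succ_iff.1 (Finset.mem_range.1 hj)
  rw [Nat.sub_sub_self hj, macdonaldCoeff]
  congr 2
  have e2 : ((ascPochhammer ℚ (2 * (m - j))).eval ((m : ℚ) - 2 * ((m - j : ℕ) : ℚ) + 3 / 2) : ℚ)
      = (ascPochhammer ℝ (2 * (m - j))).eval
        (((m : ℚ) - 2 * ((m - j : ℕ) : ℚ) + 3 / 2 : ℚ) : ℝ) := by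
    have := ascPochhammer_eval₂ (algebraMap ℚ ℝ) (2 * (m - j))
      (algebraMap ℚ ℝ ((m : ℚ) - 2 * ((m - j : ℕ) : ℚ) + 3 / 2))
    rw [Polynomial.eval₂_at_apply] at this
    exact this.symm
  rw [e2]
  congr 1
  push_cast [Nat.cast_sub hj]
  ring

/-- Termwise integration: after normalisation the moment of `h^j` has size `r^{-j}`, so the global
bound `C h^{N+1}` on the Taylor remainder contributes `O(r^{-(N+1)})`. -/
theorem hasAsymp_expMuInt : HasAsymp atTop (fun r : ℝ => r⁻¹)
    (fun r => √(r / Real.pi) * (r * Real.exp (2 * r)) * expMuInt r) cSeries := by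
  have hτ := tendsto_inv_atTop_zero_real
  refine HasAsymp.of_succ hτ fun N => ?_
  obtain ⟨C, hC0, hC⟩ := expMuFun_bound N
  set T := PowerSeries.trunc (N + 1) (expMu.map (algebraMap ℚ ℝ)) with hT
  set κ : ℕ → ℝ → ℝ := fun j r => √(r / Real.pi) * macdonald (j + 1 : ℕ) r with hκ
  have hκa : ∀ j, HasAsymp atTop (fun r : ℝ => r⁻¹) (κ j)
      (PowerSeries.mk (macdonaldCoeff (j + 1 : ℕ))) := fun j => hasAsymp_macdonald (j + 1)
  have hJ : ∀ j (r : ℝ), 0 < r → √(r / Real.pi) * (r * Real.exp (2 * r)) *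
      ∫ h in Set.Ioi 0, h ^ j * Real.exp (-h⁻¹ - r ^ 2 * h) = r⁻¹ ^ j * κ j r := fun j r hr => by
    rw [integral_pow_mul_exp hr, Real.exp_neg, pow_succ]
    have := Real.exp_pos (2 * r)
    simp only [hκ]
    field_simp
  have hmain : HasAsymp atTop (fun r : ℝ => r⁻¹)
      (fun r => ∑ j ∈ Finset.range (N + 1), ((PowerSeries.coeff j expMu : ℚ) : ℝ) *
        (r⁻¹ ^ j * κ j r))
      (∑ j ∈ Finset.range (N + 1), PowerSeries.C ((PowerSeries.coeff j expMu : ℚ) : ℝ) *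
        (PowerSeries.X ^ j * PowerSeries.mk (macdonaldCoeff (j + 1 : ℕ)))) :=
    hasAsymp_sum hτ _ fun j _ => ((((hasAsymp_self hτ).pow hτ j).mul hτ (hκa j)).const_mul _)
  have htr : PowerSeries.trunc (N + 1)
      (∑ j ∈ Finset.range (N + 1), PowerSeries.C ((PowerSeries.coeff j expMu : ℚ) : ℝ) *
        (PowerSeries.X ^ j * PowerSeries.mk (macdonaldCoeff (j + 1 : ℕ)))) =
      PowerSeries.trunc (N + 1) cSeries := by
    ext m
    rw [PowerSeries.coeff_trunc, PowerSeries.coeff_trunc]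
    split_ifs with hm
    · rw [coeff_cSeries, map_sum]
      have hsub : Finset.range (m + 1) ⊆ Finset.range (N + 1) := by
        intro x; simp only [Finset.mem_range]; omega
      rw [← Finset.sum_subset hsub]
      · refine Finset.sum_congr rfl fun j hj => ?_
        have hj : j ≤ m := Nat.lt_succ_iff.1 (Finset.mem_range.1 hj)
        rw [PowerSeries.coeff_C_mul, PowerSeries.coeff_X_pow_mul', if_pos hj, PowerSeries.coeff_mk]
      · intro j _ hj
        have hj : ¬ j ≤ m := fun h => hj (Finset.mem_range.2 (Nat.lt_succ_of_le h))
        rw [PowerSeries.coeff_C_mul, PowerSeries.coeff_X_pow_mul', if_neg hj, mul_zero]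
    · rfl
  have hrem : (fun r => √(r / Real.pi) * (r * Real.exp (2 * r)) * expMuInt r -
      ∑ j ∈ Finset.range (N + 1), ((PowerSeries.coeff j expMu : ℚ) : ℝ) * (r⁻¹ ^ j * κ j r))
      =O[atTop] fun r : ℝ => r⁻¹ ^ (N + 1) := by
    have h1 : (fun r => r⁻¹ ^ (N + 1) * κ (N + 1) r) =O[atTop] fun r : ℝ => r⁻¹ ^ (N + 1) := by
      simpa using (isBigO_refl (fun r : ℝ => r⁻¹ ^ (N + 1)) atTop).mul (hκa (N + 1)).isBigO_one
    refine IsBigO.trans (IsBigO.of_bound C ?_) h1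
    filter_upwards [eventually_gt_atTop 0] with r hr
    set μ := volume.restrict (Set.Ioi (0 : ℝ))
    have hint : ∀ j : ℕ, Integrable (fun h : ℝ => h ^ j * Real.exp (-h⁻¹ - r ^ 2 * h)) μ :=
      integrableOn_pow_mul_exp hr
    have hTint : ∀ j : ℕ, Integrable (fun h : ℝ => ((PowerSeries.coeff j expMu : ℚ) : ℝ) *
        (h ^ j * Real.exp (-h⁻¹ - r ^ 2 * h))) μ := fun j => (hint j).const_mul _
    have hTeq : ∀ h : ℝ, T.eval h * Real.exp (-h⁻¹ - r ^ 2 * h) =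
        ∑ j ∈ Finset.range (N + 1), ((PowerSeries.coeff j expMu : ℚ) : ℝ) *
          (h ^ j * Real.exp (-h⁻¹ - r ^ 2 * h)) := fun h => by
      rw [hT, eval_trunc, Finset.sum_mul]
      refine Finset.sum_congr rfl fun j _ => ?_
      rw [PowerSeries.coeff_map, mul_assoc]
      rfl
    have hTI : Integrable (fun h : ℝ => T.eval h * Real.exp (-h⁻¹ - r ^ 2 * h)) μ := by
      simp_rw [hTeq]
      exact integrable_finsetSum _ fun j _ => hTint j
    have hbd : ∀ᵐ h ∂μ, ‖(expMuFun h - T.eval h) * Real.exp (-h⁻¹ - r ^ 2 * h)‖ ≤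
        C * (h ^ (N + 1) * Real.exp (-h⁻¹ - r ^ 2 * h)) := by
      refine (ae_restrict_iff' measurableSet_Ioi).2 (ae_of_all _ fun h hh => ?_)
      rw [norm_mul, Real.norm_eq_abs, Real.norm_eq_abs, Real.abs_exp, ← mul_assoc]
      gcongr
      exact hC h hh
    have hdI : Integrable
        (fun h : ℝ => (expMuFun h - T.eval h) * Real.exp (-h⁻¹ - r ^ 2 * h)) μ := by
      refine ((hint (N + 1)).const_mul C).mono' ?_ hbd
      have h2 : Measurable fun h : ℝ => T.eval h := T.continuous.measurable
      have h3 : Measurable expMuFun := by unfold expMuFun; fun_prop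
      exact Measurable.aestronglyMeasurable (by fun_prop)
    have hsplit : expMuInt r =
        (∫ h, (expMuFun h - T.eval h) * Real.exp (-h⁻¹ - r ^ 2 * h) ∂μ) +
        ∫ h, T.eval h * Real.exp (-h⁻¹ - r ^ 2 * h) ∂μ := by
      rw [← integral_add hdI hTI, expMuInt]
      congr 1
      ext h
      ring
    have hTval : √(r / Real.pi) * (r * Real.exp (2 * r)) *
        ∫ h, T.eval h * Real.exp (-h⁻¹ - r ^ 2 * h) ∂μ =
        ∑ j ∈ Finset.range (N + 1), ((PowerSeries.coeff j expMu : ℚ) : ℝ) * (r⁻¹ ^ j * κ j r) := by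
      simp_rw [hTeq]
      rw [integral_finsetSum _ fun j _ => hTint j, Finset.mul_sum]
      refine Finset.sum_congr rfl fun j _ => ?_
      rw [integral_const_mul, mul_left_comm, hJ j r hr]
    rw [hsplit, mul_add, hTval, add_sub_cancel_right, norm_mul,
      Real.norm_of_nonneg (by positivity : 0 ≤ √(r / Real.pi) * (r * Real.exp (2 * r)))]
    calc √(r / Real.pi) * (r * Real.exp (2 * r)) *
          ‖∫ h, (expMuFun h - T.eval h) * Real.exp (-h⁻¹ - r ^ 2 * h) ∂μ‖
        ≤ √(r / Real.pi) * (r * Real.exp (2 * r)) *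
          ∫ h, C * (h ^ (N + 1) * Real.exp (-h⁻¹ - r ^ 2 * h)) ∂μ := by
          gcongr
          exact norm_integral_le_of_norm_le ((hint (N + 1)).const_mul C) hbd
      _ = C * (r⁻¹ ^ (N + 1) * κ (N + 1) r) := by
          rw [integral_const_mul, mul_left_comm, hJ (N + 1) r hr]
      _ ≤ _ := by gcongr; exact Real.le_norm_self _
  have h2 := hmain (N + 1)
  rw [htr] at h2
  refine (hrem.add h2).congr_left fun r => ?_
  ring

/-! ### Maclaurin coefficients and the recurrence for `a_n`. -/

theorem maclaurinCoeff_eq_of_hasSum {f : ℂ → ℂ} {u : ℕ → ℂ}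
    (h : ∀ᶠ z in 𝓝 0, HasSum (fun n => z ^ n * u n) (f z)) (n : ℕ) : maclaurinCoeff f n = u n := by
  have h1 : HasFPowerSeriesAt f (.ofScalars ℂ u) 0 := by
    rw [hasFPowerSeriesAt_iff]
    simpa using h
  obtain ⟨r, hr⟩ := h1
  have h2 := hr.factorial_smul 1 n
  rw [← iteratedDeriv_eq_iteratedFDeriv] at h2
  rw [maclaurinCoeff, ← h2]
  have : (n.factorial : ℂ) ≠ 0 := by exact_mod_cast n.factorial_ne_zero
  simp [this]

theorem hasSum_maclaurinCoeff {f : ℂ → ℂ} (hf : AnalyticAt ℂ f 0) :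
    ∀ᶠ z in 𝓝 0, HasSum (fun n => z ^ n * maclaurinCoeff f n) (f z) := by
  obtain ⟨p, hp⟩ := hf
  rw [hasFPowerSeriesAt_iff] at hp
  simp only [zero_add, smul_eq_mul] at hp
  simpa only [← maclaurinCoeff_eq_of_hasSum hp] using hp

theorem maclaurinCoeff_deriv (f : ℂ → ℂ) (n : ℕ) :
    maclaurinCoeff (deriv f) n = (n + 1) * maclaurinCoeff f (n + 1) := by
  have : (n.factorial : ℂ) ≠ 0 := by exact_mod_cast n.factorial_ne_zero
  have h2 : (n : ℂ) + 1 ≠ 0 := by exact_mod_cast n.succ_ne_zero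
  rw [maclaurinCoeff, maclaurinCoeff, ← iteratedDeriv_succ', Nat.factorial_succ]
  push_cast
  field_simp

theorem hasSum_mul_self {z s : ℂ} {u : ℕ → ℂ} (h : HasSum (fun n => z ^ n * u n) s) :
    HasSum (fun n => z ^ n * (Nat.casesOn n 0 u : ℂ)) (z * s) := by
  rw [← hasSum_nat_add_iff' 1]
  simpa [pow_succ', mul_assoc] using h.mul_left z

theorem analyticAt_f₀ : AnalyticAt ℂ f₀ 0 := by
  unfold f₀
  exact (analyticAt_id.div (analyticAt_const.sub analyticAt_id) (by simp)).cexp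

/-- This is `(1 - z)² f₀' = f₀`, expanded so that each term is a shift of the coefficients of `f₀'`.
-/
theorem deriv_f₀ : ∀ᶠ z in 𝓝 0,
    deriv f₀ z - 2 * (z * deriv f₀ z) + z * (z * deriv f₀ z) = f₀ z := by
  have : ∀ᶠ z : ℂ in 𝓝 0, z ≠ 1 := eventually_ne_nhds (by simp)
  filter_upwards [this] with z hz
  have hz' : 1 - z ≠ 0 := sub_ne_zero.2 hz.symm
  have h1 : HasDerivAt f₀ (f₀ z * ((1 * (1 - z) - z * (-1)) / (1 - z) ^ 2)) z :=
    ((hasDerivAt_id z).div ((hasDerivAt_id z).const_sub 1) hz').cexp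
  rw [h1.deriv]
  field_simp
  ring

theorem hasSum_f₀ : ∀ᶠ z in 𝓝 0, HasSum (fun n => z ^ n *
    (maclaurinCoeff (deriv f₀) n - 2 * (Nat.casesOn n 0 (maclaurinCoeff (deriv f₀)) : ℂ) +
      (Nat.casesOn n 0 fun n => Nat.casesOn n 0 (maclaurinCoeff (deriv f₀)) : ℂ))) (f₀ z) := by
  filter_upwards [hasSum_maclaurinCoeff analyticAt_f₀.deriv, deriv_f₀] with z h1 h2
  have h3 := hasSum_mul_self h1
  have h4 := hasSum_mul_self h3
  rw [← h2]
  refine ((h1.sub (h3.mul_left 2)).add h4).congr_fun fun n => ?_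
  ring

theorem a_zero : a 0 = 1 := by simp [a, maclaurinCoeff, f₀]

theorem a_one : a 1 = 1 := by
  have h := maclaurinCoeff_eq_of_hasSum hasSum_f₀ 0
  rw [maclaurinCoeff_deriv] at h
  have h0 := a_zero
  unfold a at *
  simp [h0] at h
  simpa using h.symm

theorem a_recurrence (n : ℕ) : (n + 2) * a (n + 2) - (2 * n + 3) * a (n + 1) + n * a n = 0 := by
  have h := maclaurinCoeff_eq_of_hasSum hasSum_f₀ (n + 1)
  unfold a
  cases n with
  | zero =>
    simp only [maclaurinCoeff_deriv] at h
    -- For `n = 0` the doubly shifted sequence takes its default value `0`, in agreement with the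
    -- term `n a_n`.
    change _ = _ + 0 at h
    push_cast at h ⊢
    linear_combination -h
  | succ n =>
    simp only [maclaurinCoeff_deriv] at h
    push_cast at h ⊢
    linear_combination -h

theorem a_im (n : ℕ) : (a n).im = 0 := by
  induction n using Nat.twoStepInduction with
  | zero => simp [a_zero]
  | one => simp [a_one]
  | more n h0 h1 =>
    have h := congrArg Complex.im (a_recurrence n)
    have e1 : ((n : ℂ) + 2) = ((n + 2 : ℝ) : ℂ) := by push_cast; rfl
    have e2 : (2 * (n : ℂ) + 3) = ((2 * n + 3 : ℝ) : ℂ) := by push_cast; rfl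
    have e3 : (n : ℂ) = ((n : ℝ) : ℂ) := by push_cast; rfl
    rw [e1, e2, e3] at h
    simp only [Complex.add_im, Complex.sub_im, Complex.im_ofReal_mul, h0, h1, mul_zero, sub_zero,
      add_zero, Complex.zero_im, mul_eq_zero] at h
    exact h.resolve_left (by positivity)

theorem a_eq_re (n : ℕ) : a n = ((a n).re : ℂ) := by
  apply Complex.ext <;> simp [a_im]

theorem a_re_recurrence (n : ℕ) :
    (n + 2) * (a (n + 2)).re - (2 * n + 3) * (a (n + 1)).re + n * (a n).re = 0 := by
  have h := a_recurrence n
  rw [a_eq_re, a_eq_re (n + 1), a_eq_re n] at h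
  exact_mod_cast h

/-! ### The integral for `b_n`, its recurrence, and the exact Casoratian. -/

/-- `∫_0^∞ e^{-s} s^k / (1 + s)^{k+2} ds`, which is `-b_{k+1}`. -/
noncomputable def bInt (k : ℕ) : ℝ :=
  ∫ s in Set.Ioi (0 : ℝ), Real.exp (-s) * (s ^ k / (1 + s) ^ (k + 2))

theorem pow_div_one_add_pow_le_one {s : ℝ} (hs : 0 ≤ s) {i j : ℕ} (hij : i ≤ j) :
    s ^ i / (1 + s) ^ j ≤ 1 := by
  rw [div_le_one (by positivity)]
  calc s ^ i ≤ (1 + s) ^ i := by gcongr; linarith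
    _ ≤ (1 + s) ^ j := by gcongr; linarith

theorem integrableOn_exp_neg_Ioi : IntegrableOn (fun s : ℝ => Real.exp (-s)) (Set.Ioi 0) := by
  simpa using exp_neg_integrableOn_Ioi 0 one_pos

theorem integrableOn_exp_mul_pow_div {i j : ℕ} (hij : i ≤ j) :
    IntegrableOn (fun s : ℝ => Real.exp (-s) * (s ^ i / (1 + s) ^ j)) (Set.Ioi 0) := by
  refine Integrable.mono' integrableOn_exp_neg_Ioi
    (Measurable.aestronglyMeasurable (by fun_prop))
    ((ae_restrict_iff' measurableSet_Ioi).2 (ae_of_all _ fun s hs => ?_))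
  have hs : 0 < s := hs
  rw [Real.norm_of_nonneg (by positivity)]
  exact mul_le_of_le_one_right (Real.exp_pos _).le (pow_div_one_add_pow_le_one hs.le hij)

theorem tendsto_exp_mul_pow_div {i j : ℕ} (hij : i ≤ j) :
    Tendsto (fun s : ℝ => Real.exp (-s) * (s ^ i / (1 + s) ^ j)) atTop (𝓝 0) := by
  refine squeeze_zero' (g := fun s => Real.exp (-s)) ?_ ?_ Real.tendsto_exp_neg_atTop_nhds_zero
  · filter_upwards [eventually_ge_atTop 0] with s hs
    positivity
  · filter_upwards [eventually_ge_atTop 0] with s hs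
    exact mul_le_of_le_one_right (Real.exp_pos _).le (pow_div_one_add_pow_le_one hs hij)

theorem hasDerivAt_exp_mul_pow_div (i j : ℕ) {s : ℝ} (hs : 0 ≤ s) :
    HasDerivAt (fun s : ℝ => Real.exp (-s) * (s ^ i / (1 + s) ^ j))
      (-Real.exp (-s) * (s ^ i / (1 + s) ^ j) + Real.exp (-s) *
        ((i * s ^ (i - 1) * (1 + s) ^ j - s ^ i * (j * (1 + s) ^ (j - 1))) /
          ((1 + s) ^ j) ^ 2)) s := by
  have h1 : HasDerivAt (fun s : ℝ => Real.exp (-s)) (-Real.exp (-s)) s := by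
    simpa using (hasDerivAt_neg s).exp
  have h2 : HasDerivAt (fun s : ℝ => (1 + s) ^ j) (j * (1 + s) ^ (j - 1)) s := by
    simpa using! ((hasDerivAt_id s).const_add 1).pow j
  exact h1.mul ((hasDerivAt_pow i s).div h2 (by positivity))

/-- The combined integrand is the derivative of `e^{-s} s^{k+1} / (1+s)^{k+3}`, which vanishes at
both ends. With `n = k + 1` this is the recurrence of `a_n`. -/
theorem bInt_recurrence (k : ℕ) :
    (k + 3) * bInt (k + 2) - (2 * k + 5) * bInt (k + 1) + (k + 1) * bInt k = 0 := by
  have i0 := (integrableOn_exp_mul_pow_div (show k ≤ k + 2 by omega)).const_mul ((k : ℝ) + 1)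
  have i1 := (integrableOn_exp_mul_pow_div (show k + 1 ≤ k + 1 + 2 by omega)).const_mul
    (2 * (k : ℝ) + 5)
  have i2 := (integrableOn_exp_mul_pow_div (show k + 2 ≤ k + 2 + 2 by omega)).const_mul
    ((k : ℝ) + 3)
  have hd : ∀ s ∈ Set.Ici (0 : ℝ), HasDerivAt
      (fun s : ℝ => Real.exp (-s) * (s ^ (k + 1) / (1 + s) ^ (k + 3)))
      ((k + 3) * (Real.exp (-s) * (s ^ (k + 2) / (1 + s) ^ (k + 2 + 2)))
        - (2 * k + 5) * (Real.exp (-s) * (s ^ (k + 1) / (1 + s) ^ (k + 1 + 2)))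
        + (k + 1) * (Real.exp (-s) * (s ^ k / (1 + s) ^ (k + 2)))) s := fun s hs => by
    have hs : 0 ≤ s := hs
    refine (hasDerivAt_exp_mul_pow_div _ _ hs).congr_deriv ?_
    have : 1 + s ≠ 0 := by positivity
    simp only [Nat.add_sub_cancel, show k + 3 - 1 = k + 2 by omega]
    push_cast
    field_simp
    ring
  have h := integral_Ioi_of_hasDerivAt_of_tendsto' hd ((i2.sub i1).add i0)
    (tendsto_exp_mul_pow_div (by omega))
  have h' := integral_add (i2.sub i1) i0
  have h'' := integral_sub i2 i1
  simp only [Pi.sub_apply] at h h' h''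
  rw [h', h'', integral_const_mul, integral_const_mul, integral_const_mul] at h
  simpa [bInt] using h

/-- The recurrence one step earlier, where the primitive `-e^{-s} / (2 (1+s)²)` leaves a boundary
term at `s = 0`. It supplies the initial value of the Casoratian. -/
theorem bInt_zero_one : 3 / 2 * bInt 0 - bInt 1 = 1 / 2 := by
  have i0 := (integrableOn_exp_mul_pow_div (show 0 ≤ 0 + 2 by omega)).const_mul (3 / 2 : ℝ)
  have i1 := (integrableOn_exp_mul_pow_div (show 1 ≤ 1 + 2 by omega))
  have hd : ∀ s ∈ Set.Ici (0 : ℝ), HasDerivAt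
      (fun s : ℝ => (-1 / 2) * (Real.exp (-s) * (s ^ 0 / (1 + s) ^ 2)))
      (3 / 2 * (Real.exp (-s) * (s ^ 0 / (1 + s) ^ (0 + 2)))
        - (Real.exp (-s) * (s ^ 1 / (1 + s) ^ (1 + 2)))) s := fun s hs => by
    have hs : 0 ≤ s := hs
    refine ((hasDerivAt_exp_mul_pow_div 0 2 hs).const_mul (-1 / 2)).congr_deriv ?_
    have : 1 + s ≠ 0 := by positivity
    simp
    field_simp
    ring
  have h := integral_Ioi_of_hasDerivAt_of_tendsto' hd (i0.sub i1)
    ((tendsto_exp_mul_pow_div (by omega)).const_mul _)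
  have h'' := integral_sub i0 i1
  rw [h'', integral_const_mul] at h
  change 3 / 2 * bInt 0 - bInt 1 = _ at h
  rw [h]
  norm_num

/-- The two recurrences give `(n+2) W_{n+1} = n W_n` for `n = k + 1`, so `n(n+1) W_n` is constant.
-/
theorem casoratian (k : ℕ) : (a (k + 2)).re * bInt k - (a (k + 1)).re * bInt (k + 1) =
    1 / ((k + 1) * (k + 2)) := by
  induction k with
  | zero =>
    have h := a_re_recurrence 0
    have h1 : (a 1).re = 1 := by simp [a_one]
    have h2 := bInt_zero_one
    norm_num at h ⊢
    rw [h1] at h ⊢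
    have h3 : (a 2).re = 3 / 2 := by linarith
    rw [h3]
    linarith
  | succ k ih =>
    have h1 := a_re_recurrence (k + 1)
    have h2 := bInt_recurrence k
    push_cast at h1 ⊢
    have hk : ((k : ℝ) + 3) ≠ 0 := by positivity
    rw [eq_div_iff (by positivity)] at ih ⊢
    have e : k + 1 + 2 = k + 3 := rfl
    have e2 : k + 1 + 1 = k + 2 := rfl
    rw [e, e2] at h1
    rw [e, e2]
    linear_combination (k + 2 : ℝ) * bInt (k + 1) * h1 - (k + 2 : ℝ) * (a (k + 2)).re * h2 + ih

theorem one_add_sub_mul_ne_zero {s : ℝ} (hs : 0 < s) {z : ℂ} (hz : ‖z‖ < 1) :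
    (1 : ℂ) + s - s * z ≠ 0 := by
  intro h
  have h1 : (1 : ℂ) + s = s * z := sub_eq_zero.1 h
  have h2 := congrArg norm h1
  rw [norm_mul, Complex.norm_real, Real.norm_of_nonneg hs.le] at h2
  have h3 : ‖(1 : ℂ) + s‖ = 1 + s := by
    have : (1 : ℂ) + s = ((1 + s : ℝ) : ℂ) := by push_cast; rfl
    rw [this, Complex.norm_real, Real.norm_of_nonneg (by positivity)]
  nlinarith

theorem f₁_eq {z : ℂ} (hz : ‖z‖ < 1) : f₁ z =
    ∫ s in Set.Ioi (0 : ℝ), (Real.exp (-s) : ℂ) * ((1 - z) / (1 + s - s * z)) := by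
  have hz1 : 1 - z ≠ 0 := by
    intro h
    rw [← sub_eq_zero.1 h] at hz
    simp at hz
  rw [f₁, E₁, ← integral_const_mul]
  refine setIntegral_congr_fun measurableSet_Ioi fun s hs => ?_
  have h1 := one_add_sub_mul_ne_zero hs hz
  have h2 : 1 / (1 - z) + s = (1 + s - s * z) / (1 - z) := by
    field_simp
    ring
  rw [neg_add, Complex.exp_add, Complex.exp_neg, h2]
  have := Complex.exp_ne_zero (1 / (1 - z))
  push_cast
  field_simp

/-- The terms of the expansion of `e^{-s} (1 - z) / (1 + s - s z)` in powers of `z`. -/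
noncomputable def f₁Term (n : ℕ) (s : ℝ) : ℝ :=
  Nat.casesOn n (Real.exp (-s) * (s ^ 0 / (1 + s) ^ 1))
    fun k => -(Real.exp (-s) * (s ^ k / (1 + s) ^ (k + 2)))

/-- Geometric series in `sz/(1+s)`, after splitting `(1-z)/(1+s-sz)` as `1/(1+s) -
z/((1+s)(1+s-sz))`; hence the exceptional term at index `0`. -/
theorem hasSum_f₁Term {s : ℝ} (hs : 0 < s) {z : ℂ} (hz : ‖z‖ < 1) :
    HasSum (fun n => z ^ n * (f₁Term n s : ℂ))
      ((Real.exp (-s) : ℂ) * ((1 - z) / (1 + s - s * z))) := by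
  rw [← hasSum_nat_add_iff' 1]
  have hs1 : (1 : ℂ) + s ≠ 0 := by
    have : (1 : ℂ) + s = ((1 + s : ℝ) : ℂ) := by push_cast; rfl
    rw [this]
    exact_mod_cast (by positivity : (1 + s : ℝ) ≠ 0)
  have hn : ‖(s : ℂ) * z / (1 + s)‖ < 1 := by
    have : (1 : ℂ) + s = ((1 + s : ℝ) : ℂ) := by push_cast; rfl
    rw [this, norm_div, norm_mul, Complex.norm_real, Complex.norm_real,
      Real.norm_of_nonneg hs.le, Real.norm_of_nonneg (by positivity), div_lt_one (by positivity)]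
    nlinarith [norm_nonneg z]
  have h := (hasSum_geometric_of_norm_lt_one hn).mul_left (-(Real.exp (-s) : ℂ) * z / (1 + s) ^ 2)
  have h1 := one_add_sub_mul_ne_zero hs hz
  have h2 : 1 - (s : ℂ) * z / (1 + s) = (1 + s - s * z) / (1 + s) := by field_simp
  convert! h using 1
  · ext n
    simp only [f₁Term]
    push_cast
    rw [div_pow, mul_pow]
    field_simp
    ring
  · rw [h2]
    simp [f₁Term]
    field_simp
    ring

theorem integrableOn_f₁Term (n : ℕ) : IntegrableOn (f₁Term n) (Set.Ioi 0) := by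
  cases n with
  | zero => exact integrableOn_exp_mul_pow_div (by omega)
  | succ k => exact (integrableOn_exp_mul_pow_div (by omega)).neg

theorem abs_f₁Term_le (n : ℕ) {s : ℝ} (hs : 0 < s) : |f₁Term n s| ≤ Real.exp (-s) := by
  cases n with
  | zero =>
    change |Real.exp (-s) * (s ^ 0 / (1 + s) ^ 1)| ≤ _
    rw [abs_of_pos (by positivity)]
    exact mul_le_of_le_one_right (Real.exp_pos _).le (pow_div_one_add_pow_le_one hs.le (by omega))
  | succ k =>
    simp only [f₁Term]
    rw [abs_neg, abs_of_pos (by positivity)]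
    exact mul_le_of_le_one_right (Real.exp_pos _).le (pow_div_one_add_pow_le_one hs.le (by omega))

/-- The majorant `‖z‖^n e^{-s}` allows sum and integral to be interchanged. -/
theorem hasSum_f₁ {z : ℂ} (hz : ‖z‖ < 1) :
    HasSum (fun n => z ^ n * ((∫ s in Set.Ioi (0 : ℝ), f₁Term n s : ℝ) : ℂ)) (f₁ z) := by
  have h1 : ∀ n, Integrable (fun s : ℝ => z ^ n * (f₁Term n s : ℂ))
      (volume.restrict (Set.Ioi 0)) := fun n => (integrableOn_f₁Term n).ofReal.const_mul _
  have hle : ∀ n, ∫ s in Set.Ioi (0 : ℝ), ‖z ^ n * (f₁Term n s : ℂ)‖ ≤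
      ‖z‖ ^ n * ∫ s in Set.Ioi (0 : ℝ), Real.exp (-s) := fun n => by
    rw [← integral_const_mul]
    refine setIntegral_mono_on (h1 n).norm (integrableOn_exp_neg_Ioi.const_mul _) measurableSet_Ioi
      fun s hs => ?_
    rw [norm_mul, norm_pow, Complex.norm_real, Real.norm_eq_abs]
    gcongr
    exact abs_f₁Term_le n hs
  have h2 : Summable fun n => ∫ s in Set.Ioi (0 : ℝ), ‖z ^ n * (f₁Term n s : ℂ)‖ :=
    Summable.of_nonneg_of_le (fun n => integral_nonneg fun s => norm_nonneg _) hle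
      ((summable_geometric_of_lt_one (norm_nonneg z) hz).mul_right _)
  have h := hasSum_integral_of_summable_integral_norm h1 h2
  rw [f₁_eq hz]
  convert! h using 1
  · ext n
    rw [integral_const_mul, integral_complex_ofReal]
  · exact setIntegral_congr_fun measurableSet_Ioi fun s hs =>
      (hasSum_f₁Term (Set.mem_Ioi.1 hs) hz).tsum_eq.symm

theorem b_succ (k : ℕ) : b (k + 1) = -(bInt k : ℂ) := by
  have h : ∀ᶠ z : ℂ in 𝓝 0, HasSum
      (fun n => z ^ n * ((∫ s in Set.Ioi (0 : ℝ), f₁Term n s : ℝ) : ℂ)) (f₁ z) := by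
    filter_upwards [Metric.ball_mem_nhds (0 : ℂ) one_pos] with z hz
    exact hasSum_f₁ (by simpa using hz)
  rw [b, maclaurinCoeff_eq_of_hasSum h]
  simp only [f₁Term]
  rw [integral_neg, bInt]
  push_cast
  rfl

theorem image_inv_exp_sub_one :
    (fun h : ℝ => (Real.exp h - 1)⁻¹) '' Set.Ioi 0 = Set.Ioi 0 := by
  ext s
  simp only [Set.mem_image, Set.mem_Ioi]
  constructor
  · rintro ⟨h, hh, rfl⟩
    have := Real.add_one_lt_exp hh.ne'
    apply inv_pos.2
    linarith
  · intro hs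
    refine ⟨Real.log (1 + s⁻¹), Real.log_pos (by linarith [inv_pos.2 hs]), ?_⟩
    rw [Real.exp_log (by positivity)]
    simp

/-- Under `s = 1/(e^h - 1)` one has `s/(1+s) = e^{-h}`, so the rational factor with the Jacobian
becomes `e^{-(k+1)h}`, while `e^{-s} = e^{1/2} exp(μ(h)) e^{-1/h}`. -/
theorem bInt_eq_expMuInt (k : ℕ) :
    bInt k = Real.exp (1 / 2) * expMuInt (√(k + 1)) := by
  have hpos : ∀ h : ℝ, 0 < h → 0 < Real.exp h - 1 := fun h hh => by
    linarith [Real.add_one_lt_exp hh.ne']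
  rw [bInt, ← image_inv_exp_sub_one, integral_image_eq_integral_abs_deriv_smul measurableSet_Ioi
    (f' := fun h => -Real.exp h / (Real.exp h - 1) ^ 2), expMuInt, ← integral_const_mul]
  · refine setIntegral_congr_fun measurableSet_Ioi fun h hh => ?_
    have h1 := hpos h hh
    have hh : 0 < h := hh
    rw [expMuFun, ← Real.exp_add, ← Real.exp_add, Real.sq_sqrt (by positivity), neg_div, abs_neg,
      abs_of_pos (by positivity), smul_eq_mul]
    have e1 : 1 / 2 + (h⁻¹ - (Real.exp h - 1)⁻¹ - 1 / 2 + (-h⁻¹ - (k + 1) * h)) =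
        -(Real.exp h - 1)⁻¹ + -(((k + 1 : ℕ) : ℝ) * h) := by push_cast; ring
    have e2 : 1 + (Real.exp h - 1)⁻¹ = Real.exp h / (Real.exp h - 1) := by
      field_simp
      ring
    rw [e1, Real.exp_add, Real.exp_neg (_ * h), Real.exp_nat_mul, e2, div_pow, inv_pow]
    have := Real.exp_pos h
    field_simp
    ring
  · intro h hh
    have h1 := hpos h hh
    exact (((Real.hasDerivAt_exp h).sub_const 1).inv h1.ne').hasDerivWithinAt
  · intro x _ y _ hxy
    simpa using hxy

theorem bInt_pos (k : ℕ) : 0 < bInt k := by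
  rw [bInt, setIntegral_pos_iff_support_of_nonneg_ae]
  · have : Set.Ioi (0 : ℝ) ⊆
        Function.support (fun s : ℝ => Real.exp (-s) * (s ^ k / (1 + s) ^ (k + 2))) ∩
          Set.Ioi 0 := by
      intro s hs
      have hs' : 0 < s := hs
      exact ⟨by simp only [Function.mem_support]; positivity, hs⟩
    exact lt_of_lt_of_le (by simp) (measure_mono this)
  · refine (ae_restrict_iff' measurableSet_Ioi).2 (ae_of_all _ fun s hs => ?_)
    have hs : 0 < s := hs
    simp only [Pi.zero_apply]
    positivity
  · exact integrableOn_exp_mul_pow_div (by omega)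

/-! ### Tools: transfer by analyticity, and summation of increments. -/

/-- An analytic function that is `O(t^M)` along some sequence `t → 0` is `O(t^M)` near `0`. -/
theorem isBigO_pow_of_analyticAt {ι : Type*} {l : Filter ι} [l.NeBot] {f : ℝ → ℝ} {τ : ι → ℝ}
    (hf : AnalyticAt ℝ f 0) (hτ : Tendsto τ l (𝓝 0)) (hτ0 : ∀ᶠ i in l, τ i ≠ 0) {M : ℕ}
    (h : (fun i => f (τ i)) =O[l] fun i => τ i ^ M) : f =O[𝓝 0] fun t => t ^ M := by
  by_cases h0 : ∀ᶠ t in 𝓝 0, f t = 0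
  · exact (isBigO_zero _ _).congr' (h0.mono fun t ht => ht.symm) EventuallyEq.rfl
  obtain ⟨n, g, hg, hg0, hfg⟩ := hf.exists_eventuallyEq_pow_smul_nonzero_iff.2 h0
  simp only [sub_zero, smul_eq_mul] at hfg
  have hg1 : g =O[𝓝 0] fun _ => (1 : ℝ) := hg.continuousAt.isBigO_one ℝ
  have h1 : f =O[𝓝 0] fun t => t ^ n := by
    have := (isBigO_refl (fun t : ℝ => t ^ n) (𝓝 0)).mul hg1
    simp only [mul_one] at this
    exact this.congr' (hfg.mono fun t ht => ht.symm) EventuallyEq.rfl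
  rcases le_or_gt M n with hMn | hMn
  -- If the exact vanishing order `n` is below `M`, the nonvanishing cofactor would tend to `0`
  -- along the sequence.
  · exact h1.trans (isBigO_pow_pow_of_le tendsto_id hMn)
  · exfalso
    obtain ⟨d, rfl⟩ := Nat.exists_eq_add_of_lt hMn
    have h2 : (fun i => g (τ i)) =O[l] fun i => τ i ^ (d + 1) := by
      have := (isBigO_refl (fun i => (τ i ^ n)⁻¹) l).mul h
      refine this.congr' ?_ ?_
      · filter_upwards [hτ0, hτ.eventually hfg] with i hi hi2
        rw [hi2]
        field_simp
      · filter_upwards [hτ0] with i hi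
        field_simp
        ring
    have h3 : Tendsto (fun i => g (τ i)) l (𝓝 0) := by
      refine h2.trans_tendsto ?_
      simpa using hτ.pow (d + 1)
    exact hg0 (tendsto_nhds_unique (hg.continuousAt.tendsto.comp hτ) h3)

/-- Telescoping against `g`; the starting value `D K` is absorbed because `g` stays at least `g K >
0`. -/
theorem isBigO_of_sub_le {E : Type*} [NormedAddCommGroup E] {D : ℕ → E} {g : ℕ → ℝ} {C : ℝ} {K : ℕ}
    (hg : ∀ k, K ≤ k → 0 < g k) (h : ∀ k, K ≤ k → ‖D (k + 1) - D k‖ ≤ C * (g (k + 1) - g k))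
    (hmono : ∀ k, K ≤ k → g k ≤ g (k + 1)) : D =O[atTop] g := by
  have h1 : ∀ k, K ≤ k → g K ≤ g k ∧ ‖D k‖ ≤ ‖D K‖ + |C| * (g k - g K) := by
    intro k hk
    induction k, hk using Nat.le_induction with
    | base => simp
    | succ k hk ih =>
      refine ⟨ih.1.trans (hmono k hk), ?_⟩
      have h2 : ‖D (k + 1)‖ ≤ ‖D (k + 1) - D k‖ + ‖D k‖ := by
        simpa using norm_add_le (D (k + 1) - D k) (D k)
      have h3 : C * (g (k + 1) - g k) ≤ |C| * (g (k + 1) - g k) :=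
        mul_le_mul_of_nonneg_right (le_abs_self C) (sub_nonneg.2 (hmono k hk))
      have := h k hk
      linarith [ih.2]
  apply IsBigO.of_bound (‖D K‖ / g K + |C|)
  filter_upwards [eventually_ge_atTop K] with k hk
  obtain ⟨h2, h3⟩ := h1 k hk
  have hK := hg K le_rfl
  rw [Real.norm_of_nonneg (hg k hk).le]
  have h4 : ‖D K‖ ≤ ‖D K‖ / g K * g k := by
    rw [div_mul_eq_mul_div, le_div_iff₀ hK]
    gcongr
  have h5 : 0 ≤ |C| * g K := by positivity
  linarith

/-- The tail is summed by bounding `(j+1)^{-2}` by twice the telescoping difference. The further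
gain of one power is discarded. -/
theorem isBigO_sub_of_tendsto {w : ℕ → ℝ} {L : ℝ} (p : ℕ)
    (h : (fun k => w (k + 1) - w k) =O[atTop] fun k : ℕ => ((k : ℝ) + 1)⁻¹ ^ (p + 2))
    (hw : Tendsto w atTop (𝓝 L)) :
    (fun k => w k - L) =O[atTop] fun k : ℕ => ((k : ℝ) + 1)⁻¹ ^ p := by
  obtain ⟨C, hC0, hC⟩ := h.exists_pos
  rw [IsBigOWith] at hC
  obtain ⟨K, hK⟩ := eventually_atTop.1 hC
  apply IsBigO.of_bound (2 * C)
  filter_upwards [eventually_ge_atTop K] with k hk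
  have hmain : ∀ j, k ≤ j → |w j - w k| ≤
      2 * C * ((k : ℝ) + 1)⁻¹ ^ p * (((k : ℝ) + 1)⁻¹ - ((j : ℝ) + 1)⁻¹) := by
    intro j hj
    induction j, hj using Nat.le_induction with
    | base => simp
    | succ j hj ih =>
      have h1 := hK j (hk.trans hj)
      rw [Real.norm_eq_abs, Real.norm_of_nonneg (by positivity)] at h1
      have hkj : (k : ℝ) ≤ j := by exact_mod_cast hj
      have h2 : ((j : ℝ) + 1)⁻¹ ^ (p + 2) ≤
          ((k : ℝ) + 1)⁻¹ ^ p * (2 * (((j : ℝ) + 1)⁻¹ - ((j : ℝ) + 1 + 1)⁻¹)) := by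
        rw [pow_add]
        have h3 : ((j : ℝ) + 1)⁻¹ ^ 2 ≤ 2 * (((j : ℝ) + 1)⁻¹ - ((j : ℝ) + 1 + 1)⁻¹) := by
          have hj0 : (0 : ℝ) ≤ j := j.cast_nonneg
          have h4 : 2 * (((j : ℝ) + 1)⁻¹ - ((j : ℝ) + 1 + 1)⁻¹) - ((j : ℝ) + 1)⁻¹ ^ 2 =
              j / (((j : ℝ) + 1) ^ 2 * ((j : ℝ) + 2)) := by
            field_simp
            ring
          have h5 : 0 ≤ j / (((j : ℝ) + 1) ^ 2 * ((j : ℝ) + 2)) := by positivity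
          linarith
        gcongr
      have h6 := mul_le_mul_of_nonneg_left h2 hC0.le
      have h7 : |w (j + 1) - w k| ≤ |w (j + 1) - w j| + |w j - w k| := by
        simpa using abs_add_le (w (j + 1) - w j) (w j - w k)
      push_cast
      linarith
  have h8 : Tendsto (fun j => |w j - w k|) atTop (𝓝 |L - w k|) := (hw.sub_const _).abs
  rw [Real.norm_eq_abs, abs_sub_comm, Real.norm_of_nonneg (by positivity)]
  refine le_of_tendsto h8 ?_
  filter_upwards [eventually_ge_atTop k] with j hj
  refine (hmain j hj).trans ?_
  have h9 : ((k : ℝ) + 1)⁻¹ - ((j : ℝ) + 1)⁻¹ ≤ 1 := by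
    have h10 : ((k : ℝ) + 1)⁻¹ ≤ 1 := inv_le_one_of_one_le₀ (by linarith [k.cast_nonneg (α := ℝ)])
    have h11 : 0 ≤ ((j : ℝ) + 1)⁻¹ := by positivity
    linarith
  exact mul_le_of_le_one_right (by positivity) h9

/-- `e^{4√x} / x^q` gains at least the fraction `1 / (x + 1)` when `x` increases by one. -/
theorem eventually_exp_sqrt_div_pow_growth (q : ℕ) : ∀ᶠ x : ℝ in atTop,
    Real.exp (4 * √x) / x ^ q * (1 + (x + 1)⁻¹) ≤ Real.exp (4 * √(x + 1)) / (x + 1) ^ q := by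
  have hr : Tendsto (fun x : ℝ => √(x + 1)) atTop atTop :=
    Real.tendsto_sqrt_atTop.comp (tendsto_atTop_add_const_right _ _ tendsto_id)
  -- With `s = √(x+1)` the exponential gains a factor `1 + 2/s` and the denominator costs at most `1
  -- - q/s²`. The bound `s ≥ 3q + 1` leaves at least `1 + 1/s²`.
  filter_upwards [eventually_gt_atTop 0, hr.eventually_ge_atTop (3 * q + 1)] with x hx hxq
  set s := √(x + 1) with hs
  have hs2 : s ^ 2 = x + 1 := Real.sq_sqrt (by linarith)
  have hs0 : 0 < s := Real.sqrt_pos.2 (by linarith)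
  have hx2 : √x ^ 2 = x := Real.sq_sqrt hx.le
  have hle : √x ≤ s := Real.sqrt_le_sqrt (by linarith)
  have hx0 : 0 < √x := Real.sqrt_pos.2 hx
  have h1 : √x + 1 / (2 * s) ≤ s := by
    have : s - √x = 1 / (s + √x) := by
      rw [eq_div_iff (by positivity)]
      nlinarith
    have h2 : 1 / (2 * s) ≤ 1 / (s + √x) := by
      apply one_div_le_one_div_of_le <;> linarith
    linarith
  have h2 : Real.exp (4 * √x) * (1 + 2 / s) ≤ Real.exp (4 * s) := by
    calc Real.exp (4 * √x) * (1 + 2 / s) ≤ Real.exp (4 * √x) * Real.exp (2 / s) := by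
          gcongr
          linarith [Real.add_one_le_exp (2 / s)]
      _ = Real.exp (4 * (√x + 1 / (2 * s))) := by
          rw [← Real.exp_add]
          congr 1
          field_simp
          ring
      _ ≤ _ := by gcongr
  have hx1 : 0 < x + 1 := by linarith
  have h3 : 1 - q / s ^ 2 ≤ (x / (x + 1)) ^ q := by
    have h4 := one_add_mul_le_pow (a := -(1 / (x + 1))) (by
      have : 1 / (x + 1) ≤ 1 := by rw [div_le_one hx1]; linarith
      linarith) q
    have h5 : 1 + -(1 / (x + 1)) = x / (x + 1) := by field_simp; ring
    rw [h5] at h4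
    rw [hs2]
    refine le_trans (le_of_eq ?_) h4
    ring
  have hq0 : (0 : ℝ) ≤ q := q.cast_nonneg
  have hs1 : 1 ≤ s := by linarith
  have h6 : 1 + (s ^ 2)⁻¹ ≤ (1 + 2 / s) * (1 - q / s ^ 2) := by
    have h7 : (1 + 2 / s) * (1 - q / s ^ 2) - (1 + (s ^ 2)⁻¹) =
        (2 * s ^ 2 - (q + 1) * s - 2 * q) / s ^ 3 := by
      field_simp
      ring
    have h8 : 0 ≤ (2 * s ^ 2 - (q + 1) * s - 2 * q) / s ^ 3 := by
      apply div_nonneg _ (by positivity)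
      nlinarith
    linarith
  rw [← hs2] at *
  calc Real.exp (4 * √x) / x ^ q * (1 + (s ^ 2)⁻¹)
      ≤ Real.exp (4 * √x) / x ^ q * ((1 + 2 / s) * (x / s ^ 2) ^ q) := by
        gcongr
        exact h6.trans (by gcongr)
    _ = Real.exp (4 * √x) * (1 + 2 / s) / (s ^ 2) ^ q := by
        rw [div_pow]
        field_simp
    _ ≤ _ := by gcongr

/-! ### Approximate solutions for both signs of `t`. -/

/-- The dominant factor `x^{-3/4} e^{-2 ε √x}` of the solutions, for `ε = ± 1`. -/
noncomputable def gauge (ε x : ℝ) : ℝ := Real.exp (-(2 * (ε * √x))) / (√x * √√x)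

/-- The quotient of `gauge` at `x + c` and at `x`, as a function of `t = ε / √x`. -/
noncomputable def gaugeRatio (c t : ℝ) : ℝ :=
  (√(1 + c * t ^ 2) * √√(1 + c * t ^ 2))⁻¹ * Real.exp (-(2 * c * t / (√(1 + c * t ^ 2) + 1)))

/-- The argument `ε / √(x + c)` as a function of `t = ε / √x`. -/
noncomputable def argShift (c t : ℝ) : ℝ := t / √(1 + c * t ^ 2)

theorem gauge_pos (ε : ℝ) {x : ℝ} (hx : 0 < x) : 0 < gauge ε x := by
  have := Real.sqrt_pos.2 hx
  have := Real.sqrt_pos.2 this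
  unfold gauge
  positivity

/-- The exponentials of the recessive and the dominant solution cancel; this is the source of
`n^{-3/2}`. -/
theorem gauge_mul_gauge_neg {x : ℝ} (hx : 0 < x) : gauge 1 x * gauge (-1) x = (√x)⁻¹ ^ 3 := by
  have h1 := Real.sqrt_pos.2 hx
  have h2 := Real.sqrt_pos.2 h1
  have h3 := Real.sq_sqrt h1.le
  have h4 : Real.exp (-(2 * (1 * √x))) * Real.exp (-(2 * (-1 * √x))) = 1 := by
    rw [← Real.exp_add]
    simp
  rw [gauge, gauge, div_mul_div_comm, h4]
  have h5 : √x * √√x * (√x * √√x) = √x ^ 3 := by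
    calc √x * √√x * (√x * √√x) = √x ^ 2 * √√x ^ 2 := by ring
      _ = √x ^ 3 := by rw [h3]; ring
  rw [h5, inv_pow, one_div]

theorem sqrt_add_eq {ε x c : ℝ} (hε : ε ^ 2 = 1) (hx : 0 < x) (hc : 0 ≤ c) :
    √(x + c) = √x * √(1 + c * (ε * (√x)⁻¹) ^ 2) := by
  have h1 := Real.sqrt_pos.2 hx
  rw [← Real.sqrt_mul hx.le, mul_pow, hε, inv_pow, Real.sq_sqrt hx.le]
  congr 1
  field_simp

theorem argShift_eq {ε x c : ℝ} (hε : ε ^ 2 = 1) (hx : 0 < x) (hc : 0 ≤ c) :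
    argShift c (ε * (√x)⁻¹) = ε * (√(x + c))⁻¹ := by
  rw [argShift, sqrt_add_eq hε hx hc, mul_inv]
  ring

/-- Rationalising `√(x+c) - √x` makes the quotient a function of `t = ε/√x` alone, analytic at `0`
and the same for both signs. -/
theorem gauge_add {ε x c : ℝ} (hε : ε ^ 2 = 1) (hx : 0 < x) (hc : 0 ≤ c) :
    gauge ε (x + c) = gauge ε x * gaugeRatio c (ε * (√x)⁻¹) := by
  have h1 := Real.sqrt_pos.2 hx
  have h2 := Real.sqrt_pos.2 h1
  have h0 := sqrt_add_eq hε hx hc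
  set u := √(1 + c * (ε * (√x)⁻¹) ^ 2) with hu
  have hu2 : u ^ 2 = 1 + c * (ε * (√x)⁻¹) ^ 2 := Real.sq_sqrt (by positivity)
  have hu0 : 0 < u := Real.sqrt_pos.2 (by positivity)
  have hu1 := Real.sqrt_pos.2 hu0
  rw [gauge, gaugeRatio, ← hu, h0, Real.sqrt_mul h1.le, gauge]
  have h3 : -(2 * (ε * (√x * u))) =
      -(2 * (ε * √x)) + -(2 * c * (ε * (√x)⁻¹) / (u + 1)) := by
    rw [mul_pow, hε] at hu2
    have h4 : c * (√x)⁻¹ = (u ^ 2 - 1) * √x := by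
      rw [hu2]
      field_simp
      ring
    have h5 : 2 * c * (ε * (√x)⁻¹) / (u + 1) = 2 * ε * ((u - 1) * √x) := by
      rw [div_eq_iff (by positivity)]
      linear_combination 2 * ε * h4
    rw [h5]
    ring
  rw [h3, Real.exp_add]
  field_simp

/-- The residual of the three term recurrence for an approximate solution with the asymptotic
polynomial `P`, as a function of `t = ε / √x`. -/
noncomputable def residual (P : Polynomial ℝ) (t : ℝ) : ℝ :=
  (1 + 2 * t ^ 2) * gaugeRatio 2 t * P.eval (argShift 2 t)
    - (2 + 3 * t ^ 2) * gaugeRatio 1 t * P.eval (argShift 1 t) + P.eval t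

/-- The approximate solution of the recurrence with asymptotic polynomial `P`. -/
noncomputable def approxSol (P : Polynomial ℝ) (ε x : ℝ) : ℝ :=
  gauge ε x * P.eval (ε * (√x)⁻¹)

theorem approxSol_recurrence (P : Polynomial ℝ) {ε x : ℝ} (hε : ε ^ 2 = 1) (hx : 0 < x) :
    (x + 2) * approxSol P ε (x + 2) - (2 * x + 3) * approxSol P ε (x + 1) + x * approxSol P ε x =
      x * gauge ε x * residual P (ε * (√x)⁻¹) := by
  have h1 := Real.sqrt_pos.2 hx
  have ht : (ε * (√x)⁻¹) ^ 2 = x⁻¹ := by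
    rw [mul_pow, hε, inv_pow, Real.sq_sqrt hx.le, one_mul]
  unfold approxSol residual
  rw [gauge_add hε hx zero_le_two, gauge_add hε hx zero_le_one, argShift_eq hε hx zero_le_two,
    argShift_eq hε hx zero_le_one, ht]
  field_simp

theorem contDiffAt_sqrt_one_add (c : ℝ) :
    ContDiffAt ℝ ω (fun t : ℝ => √(1 + c * t ^ 2)) 0 :=
  ContDiffAt.sqrt (by fun_prop) (by simp)

theorem contDiffAt_gaugeRatio (c : ℝ) : ContDiffAt ℝ ω (gaugeRatio c) 0 := by
  have h1 := contDiffAt_sqrt_one_add c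
  have h2 : ContDiffAt ℝ ω (fun t : ℝ => √√(1 + c * t ^ 2)) 0 := h1.sqrt (by simp)
  unfold gaugeRatio
  refine ((h1.mul h2).inv (by simp)).mul (ContDiffAt.exp (ContDiffAt.neg ?_))
  exact ContDiffAt.div (by fun_prop) (h1.add contDiffAt_const) (by norm_num)

theorem contDiffAt_argShift (c : ℝ) : ContDiffAt ℝ ω (argShift c) 0 :=
  contDiffAt_id.div (contDiffAt_sqrt_one_add c) (by simp)

theorem argShift_zero (c : ℝ) : argShift c 0 = 0 := by simp [argShift]

theorem gaugeRatio_zero (c : ℝ) : gaugeRatio c 0 = 1 := by simp [gaugeRatio]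

theorem contDiffAt_eval (P : Polynomial ℝ) (x : ℝ) : ContDiffAt ℝ ω (fun t => P.eval t) x := by
  simpa using (P.contDiff_aeval (𝕜 := ℝ) ω).contDiffAt (x := x)

theorem contDiffAt_eval_argShift (P : Polynomial ℝ) (c : ℝ) :
    ContDiffAt ℝ ω (fun t => P.eval (argShift c t)) 0 :=
  ContDiffAt.comp (g := fun t => P.eval t) 0 (contDiffAt_eval P _) (contDiffAt_argShift c)

theorem analyticAt_residual (P : Polynomial ℝ) : AnalyticAt ℝ (residual P) 0 := by
  have h : ContDiffAt ℝ ω (residual P) 0 := by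
    refine ContDiffAt.add (ContDiffAt.sub ?_ ?_) (contDiffAt_eval P _)
    · exact (ContDiffAt.mul (by fun_prop) (contDiffAt_gaugeRatio 2)).mul
        (contDiffAt_eval_argShift P 2)
    · exact (ContDiffAt.mul (by fun_prop) (contDiffAt_gaugeRatio 1)).mul
        (contDiffAt_eval_argShift P 1)
  exact h.analyticAt

theorem hasDerivAt_sqrt_one_add (c : ℝ) : HasDerivAt (fun t : ℝ => √(1 + c * t ^ 2)) 0 0 := by
  have h : HasDerivAt (fun t : ℝ => 1 + c * t ^ 2) 0 0 := by
    simpa using ((hasDerivAt_pow 2 (0 : ℝ)).const_mul c).const_add 1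
  simpa using h.sqrt (by simp)

theorem hasDerivAt_argShift (c : ℝ) : HasDerivAt (argShift c) 1 0 := by
  simpa using! (hasDerivAt_id (0 : ℝ)).div (hasDerivAt_sqrt_one_add c) (by simp)

theorem hasDerivAt_gaugeRatio (c : ℝ) : HasDerivAt (gaugeRatio c) (-c) 0 := by
  have h1 := hasDerivAt_sqrt_one_add c
  have h2 : HasDerivAt (fun t : ℝ => √√(1 + c * t ^ 2)) 0 0 := by
    simpa using h1.sqrt (by simp)
  have h3 : HasDerivAt (fun t : ℝ => 2 * c * t) (2 * c) 0 := by
    simpa using (hasDerivAt_id (0 : ℝ)).const_mul (2 * c)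
  have h4 := ((h1.mul h2).inv (by simp)).mul ((h3.div (h1.add_const 1) (by norm_num)).neg.exp)
  refine HasDerivAt.congr_deriv h4 ?_
  norm_num
  ring

/-- The Casoratian of the two approximate solutions, divided by their dominant factors. -/
noncomputable def scaledCasoratian (P : Polynomial ℝ) (t : ℝ) : ℝ :=
  gaugeRatio 1 (-t) * P.eval (argShift 1 (-t)) * P.eval t
    - P.eval (-t) * (gaugeRatio 1 t * P.eval (argShift 1 t))

theorem scaledCasoratian_zero (P : Polynomial ℝ) : scaledCasoratian P 0 = 0 := by
  simp [scaledCasoratian, argShift_zero]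
  ring

/-- The contributions of `P'` cancel, and each of the two factors `gaugeRatio 1 (± t)` contributes
`1`. -/
theorem hasDerivAt_scaledCasoratian {P : Polynomial ℝ} (hP : P.eval 0 = 1) :
    HasDerivAt (scaledCasoratian P) 2 0 := by
  have hn : HasDerivAt (fun t : ℝ => -t) (-1) 0 := hasDerivAt_neg 0
  have hg := hasDerivAt_gaugeRatio 1
  have ha := hasDerivAt_argShift 1
  have hp : ∀ {x : ℝ}, x = 0 → HasDerivAt (fun t => P.eval t) (P.derivative.eval 0) x := by
    rintro x rfl
    exact P.hasDerivAt 0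
  have hg' : HasDerivAt (fun t => gaugeRatio 1 (-t)) (-1 * -1) 0 :=
    HasDerivAt.comp (h₂ := gaugeRatio 1) 0 (by simpa using hg) hn
  have ha' : HasDerivAt (fun t => argShift 1 (-t)) (1 * -1) 0 :=
    HasDerivAt.comp (h₂ := argShift 1) 0 (by simpa using ha) hn
  have hpa : HasDerivAt (fun t => P.eval (argShift 1 t)) (P.derivative.eval 0 * 1) 0 :=
    HasDerivAt.comp (h₂ := fun t => P.eval t) 0 (hp (argShift_zero 1)) ha
  have hpa' : HasDerivAt (fun t => P.eval (argShift 1 (-t))) (P.derivative.eval 0 * (1 * -1)) 0 :=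
    HasDerivAt.comp (h₂ := fun t => P.eval t) 0 (hp (by simp [argShift_zero])) ha'
  have hpn : HasDerivAt (fun t => P.eval (-t)) (P.derivative.eval 0 * (-1)) 0 :=
    HasDerivAt.comp (h₂ := fun t => P.eval t) 0 (hp (by simp)) hn
  refine HasDerivAt.congr_deriv
    (((hg'.mul hpa').mul (hp rfl)).sub (hpn.mul (hg.mul hpa))) ?_
  simp [argShift_zero, gaugeRatio_zero, hP]
  ring

/-! ### Values at the integers and smallness of the residual. -/

/-- The small quantity `(k + 1)^{-1/2}`. -/
noncomputable def tSeq (k : ℕ) : ℝ := (√((k : ℝ) + 1))⁻¹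

theorem tSeq_pos (k : ℕ) : 0 < tSeq k := by
  unfold tSeq
  positivity

theorem tSeq_sq (k : ℕ) : tSeq k ^ 2 = ((k : ℝ) + 1)⁻¹ := by
  rw [tSeq, inv_pow, Real.sq_sqrt (by positivity)]

theorem tendsto_sqrt_natCast_add_one : Tendsto (fun k : ℕ => √((k : ℝ) + 1)) atTop atTop :=
  Real.tendsto_sqrt_atTop.comp (tendsto_atTop_add_const_right _ _ tendsto_natCast_atTop_atTop)

theorem tendsto_tSeq : Tendsto tSeq atTop (𝓝 0) :=
  tendsto_inv_atTop_zero.comp tendsto_sqrt_natCast_add_one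

theorem tSeq_succ_le (k : ℕ) : tSeq (k + 1) ≤ tSeq k := by
  unfold tSeq
  apply inv_anti₀ (by positivity)
  apply Real.sqrt_le_sqrt
  push_cast
  linarith

theorem argShift_tSeq {ε : ℝ} (hε : ε ^ 2 = 1) (k j : ℕ) :
    argShift j (ε * tSeq k) = ε * tSeq (k + j) := by
  rw [tSeq, argShift_eq hε (by positivity) j.cast_nonneg, tSeq]
  congr 3
  push_cast
  ring

theorem gauge_natCast_add {ε : ℝ} (hε : ε ^ 2 = 1) (k j : ℕ) :
    gauge ε (((k + j : ℕ) : ℝ) + 1) = gauge ε ((k : ℝ) + 1) * gaugeRatio j (ε * tSeq k) := by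
  rw [tSeq, ← gauge_add hε (by positivity) j.cast_nonneg]
  congr 1
  push_cast
  ring

/-- The values of the Laplace integral at the integers, divided by their dominant factors. -/
noncomputable def betaSeq (k : ℕ) : ℝ :=
  √(√((k : ℝ) + 1) / Real.pi) * (√((k : ℝ) + 1) * Real.exp (2 * √((k : ℝ) + 1))) *
    expMuInt √((k : ℝ) + 1)

theorem hasAsymp_betaSeq : HasAsymp atTop tSeq betaSeq cSeries :=
  hasAsymp_expMuInt.comp tendsto_sqrt_natCast_add_one

/-- The constant factor `√(π e)`. -/
noncomputable def scaleConst : ℝ := √Real.pi * Real.exp (1 / 2)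

theorem scaleConst_pos : 0 < scaleConst := by
  have := Real.sqrt_pos.2 Real.pi_pos
  unfold scaleConst
  positivity

theorem bInt_eq_betaSeq (k : ℕ) : bInt k = scaleConst * gauge 1 ((k : ℝ) + 1) * betaSeq k := by
  have h1 : 0 < √((k : ℝ) + 1) := by positivity
  have h2 := Real.sqrt_pos.2 h1
  have h3 := Real.sqrt_pos.2 Real.pi_pos
  rw [bInt_eq_expMuInt, scaleConst, gauge, betaSeq, Real.sqrt_div h1.le, one_mul, Real.exp_neg]
  have := Real.exp_pos (2 * √((k : ℝ) + 1))
  field_simp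

theorem betaSeq_pos (k : ℕ) : 0 < betaSeq k := by
  have h := bInt_pos k
  rw [bInt_eq_betaSeq] at h
  exact pos_of_mul_pos_right h
    (mul_pos scaleConst_pos (gauge_pos 1 (by positivity))).le

theorem constantCoeff_expMu : PowerSeries.coeff 0 expMu = 1 := by
  rw [expMu, PowerSeries.coeff_subst' hasSubst_mu, finsum_eq_single _ 0]
  · simp
  · intro n hn
    rw [PowerSeries.coeff_zero_eq_constantCoeff_apply, map_pow, constantCoeff_mu, zero_pow hn,
      smul_zero]

theorem c_zero : c 0 = 1 := by
  simp [c, constantCoeff_expMu]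

theorem d_zero : d 0 = 1 := by
  simp [d, c_zero]

theorem coeff_zero_cSeries : PowerSeries.coeff 0 cSeries = 1 := by
  simp [cSeries, c_zero]

theorem tendsto_betaSeq : Tendsto betaSeq atTop (𝓝 1) := by
  have h := hasAsymp_betaSeq 1
  simp only [PowerSeries.trunc_one_left, coeff_zero_cSeries, Polynomial.eval_C, pow_one] at h
  simpa using (h.trans_tendsto tendsto_tSeq).add_const 1

theorem eval_zero_trunc_cSeries (M : ℕ) : (PowerSeries.trunc (M + 1) cSeries).eval 0 = 1 := by
  rw [← Polynomial.coeff_zero_eq_eval_zero, PowerSeries.coeff_trunc, if_pos (by omega),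
    coeff_zero_cSeries]

/-- The expression defining `residual`, with exact values in place of those of `P`. Subtracting the
two bounds the residual by the error of the expansion. -/
theorem betaSeq_recurrence (k : ℕ) :
    (1 + 2 * tSeq k ^ 2) * gaugeRatio 2 (tSeq k) * betaSeq (k + 2)
      - (2 + 3 * tSeq k ^ 2) * gaugeRatio 1 (tSeq k) * betaSeq (k + 1) + betaSeq k = 0 := by
  have h := bInt_recurrence k
  have h1 := gauge_natCast_add (one_pow 2) k 1
  have h2 := gauge_natCast_add (one_pow 2) k 2
  rw [one_mul] at h1 h2
  rw [bInt_eq_betaSeq, bInt_eq_betaSeq, bInt_eq_betaSeq, h1, h2] at h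
  have hs := scaleConst_pos
  have hg := gauge_pos 1 (by positivity : 0 < (k : ℝ) + 1)
  have h0 : scaleConst * gauge 1 ((k : ℝ) + 1) * ((k : ℝ) + 1) ≠ 0 := by positivity
  rw [tSeq_sq]
  apply mul_left_cancel₀ h0
  rw [mul_zero, ← h]
  push_cast
  field_simp
  ring

theorem isBigO_tSeq_add {f : ℕ → ℝ} {M : ℕ} (j : ℕ) (h : f =O[atTop] fun k => tSeq k ^ M) :
    (fun k => f (k + j)) =O[atTop] fun k => tSeq k ^ M := by
  refine (h.comp_tendsto (tendsto_add_atTop_nat j)).trans (isBigO_of_le _ fun k => ?_)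
  have : ∀ j, tSeq (k + j) ≤ tSeq k := fun j => by
    induction j with
    | zero => exact le_rfl
    | succ j ih => exact (tSeq_succ_le (k + j)).trans ih
  simp only [Function.comp_apply, norm_pow, Real.norm_of_nonneg (tSeq_pos _).le]
  exact pow_le_pow_left₀ (tSeq_pos _).le (this j) M

theorem isBigO_one_of_continuousAt {f : ℝ → ℝ} {τ : ℕ → ℝ} (hf : ContinuousAt f 0)
    (hτ : Tendsto τ atTop (𝓝 0)) : (fun k => f (τ k)) =O[atTop] fun _ => (1 : ℝ) :=
  (hf.tendsto.comp hτ).isBigO_one ℝ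

theorem continuousAt_gaugeRatio (c : ℝ) : ContinuousAt (gaugeRatio c) 0 :=
  (contDiffAt_gaugeRatio c).continuousAt

/-- The truncations of the formal solution solve the recurrence approximately, at `0⁺` by the
asymptotic expansion, hence also at `0⁻` by analyticity. -/
theorem isBigO_residual (M : ℕ) :
    residual (PowerSeries.trunc M cSeries) =O[𝓝 0] fun t => t ^ M := by
  set P := PowerSeries.trunc M cSeries with hP
  refine isBigO_pow_of_analyticAt (analyticAt_residual P) tendsto_tSeq
    (Eventually.of_forall fun k => (tSeq_pos k).ne') ?_
  have hδ : (fun k => betaSeq k - P.eval (tSeq k)) =O[atTop] fun k => tSeq k ^ M :=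
    hasAsymp_betaSeq M
  have h2 := (isBigO_one_of_continuousAt (f := fun t => (1 + 2 * t ^ 2) * gaugeRatio 2 t)
    (ContinuousAt.mul (by fun_prop) (continuousAt_gaugeRatio 2)) tendsto_tSeq).mul
    (isBigO_tSeq_add 2 hδ)
  have h1 := (isBigO_one_of_continuousAt (f := fun t => (2 + 3 * t ^ 2) * gaugeRatio 1 t)
    (ContinuousAt.mul (by fun_prop) (continuousAt_gaugeRatio 1)) tendsto_tSeq).mul
    (isBigO_tSeq_add 1 hδ)
  simp only [one_mul] at h1 h2
  refine ((h1.sub h2).sub hδ).congr_left fun k => ?_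
  have e1 := argShift_tSeq (one_pow 2) k 1
  have e2 := argShift_tSeq (one_pow 2) k 2
  simp only [one_mul, Nat.cast_one, Nat.cast_ofNat] at e1 e2
  have h := betaSeq_recurrence k
  rw [residual, e1, e2]
  linear_combination -h

/-! ### The Casoratian of the approximate solutions. -/

/-- `n (n + 1)` times the Casoratian of the two approximate solutions, at `n = k + 1`. -/
noncomputable def approxCasoratian (P : Polynomial ℝ) (k : ℕ) : ℝ :=
  ((k : ℝ) + 1) * ((k : ℝ) + 2) *
    (approxSol P (-1) ((k + 1 : ℕ) + 1) * approxSol P 1 (k + 1)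
      - approxSol P (-1) (k + 1) * approxSol P 1 ((k + 1 : ℕ) + 1))

theorem mul_mul_gauge_mul_gauge (k : ℕ) : ((k : ℝ) + 1) * ((k : ℝ) + 2) *
    (gauge 1 ((k : ℝ) + 1) * gauge (-1) ((k : ℝ) + 1)) = (1 + tSeq k ^ 2) * (tSeq k)⁻¹ := by
  have h := tSeq_sq k
  have h0 := (tSeq_pos k).ne'
  have h1 : ((k : ℝ) + 1) = (tSeq k ^ 2)⁻¹ := by rw [h, inv_inv]
  have h2 : ((k : ℝ) + 2) = (tSeq k ^ 2)⁻¹ + 1 := by rw [← h1]; ring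
  rw [gauge_mul_gauge_neg (by positivity)]
  change ((k : ℝ) + 1) * ((k : ℝ) + 2) * tSeq k ^ 3 = _
  rw [h2, h1]
  field_simp

theorem approxSol_natCast_add_one (P : Polynomial ℝ) (ε : ℝ) (k : ℕ) :
    approxSol P ε ((k : ℝ) + 1) = gauge ε ((k : ℝ) + 1) * P.eval (ε * tSeq k) := rfl

theorem approxSol_succ (P : Polynomial ℝ) {ε : ℝ} (hε : ε ^ 2 = 1) (k : ℕ) :
    approxSol P ε (((k + 1 : ℕ) : ℝ) + 1) =
      gauge ε ((k : ℝ) + 1) * gaugeRatio 1 (ε * tSeq k) * P.eval (argShift 1 (ε * tSeq k)) := by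
  have h1 := argShift_tSeq hε k 1
  have h2 := gauge_natCast_add hε k 1
  rw [Nat.cast_one] at h1 h2
  rw [approxSol_natCast_add_one, h1, h2]

theorem approxCasoratian_eq (P : Polynomial ℝ) (k : ℕ) : approxCasoratian P k =
    (1 + tSeq k ^ 2) * ((tSeq k)⁻¹ * scaledCasoratian P (tSeq k)) := by
  rw [← mul_assoc, ← mul_mul_gauge_mul_gauge, approxCasoratian, approxSol_succ P (by norm_num),
    approxSol_succ P (one_pow 2), approxSol_natCast_add_one, approxSol_natCast_add_one,
    scaledCasoratian]
  simp only [one_mul, neg_one_mul]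
  ring

/-- The prefactor `(1 + t²)/t` turns `scaledCasoratian`, which vanishes at `0`, into its slope
there. -/
theorem tendsto_approxCasoratian {P : Polynomial ℝ} (hP : P.eval 0 = 1) :
    Tendsto (approxCasoratian P) atTop (𝓝 2) := by
  have h1 := (hasDerivAt_scaledCasoratian hP).tendsto_slope
  have h2 : Tendsto tSeq atTop (𝓝[≠] 0) :=
    tendsto_nhdsWithin_iff.2 ⟨tendsto_tSeq, Eventually.of_forall fun k => (tSeq_pos k).ne'⟩
  have h3 := h1.comp h2
  have h4 := ((tendsto_tSeq.pow 2).const_add 1).mul h3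
  norm_num at h4
  refine h4.congr fun k => ?_
  rw [approxCasoratian_eq]
  simp [slope, scaledCasoratian_zero]

/-- For exact solutions the quantity is constant, so its increment is linear in the two residuals.
-/
theorem approxCasoratian_succ_sub (P : Polynomial ℝ) (k : ℕ) :
    approxCasoratian P (k + 1) - approxCasoratian P k = (1 + tSeq k ^ 2) * (tSeq k)⁻¹ *
      (residual P (-tSeq k) * (gaugeRatio 1 (tSeq k) * P.eval (argShift 1 (tSeq k)))
        - residual P (tSeq k) * (gaugeRatio 1 (-tSeq k) * P.eval (argShift 1 (-tSeq k)))) := by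
  have hx : 0 < (k : ℝ) + 1 := by positivity
  have hA := approxSol_recurrence P (ε := -1) (by norm_num) hx
  have hB := approxSol_recurrence P (ε := 1) (one_pow 2) hx
  have hA1 := approxSol_succ P (ε := -1) (by norm_num) k
  have hB1 := approxSol_succ P (ε := 1) (one_pow 2) k
  have e1 : (((k + 1 : ℕ) : ℝ) + 1) = (k : ℝ) + 1 + 1 := by push_cast; ring
  have e2 : (((k + 1 + 1 : ℕ) : ℝ) + 1) = (k : ℝ) + 1 + 2 := by push_cast; ring
  change _ = _ * residual P (-1 * tSeq k) at hA
  change _ = _ * residual P (1 * tSeq k) at hB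
  rw [← mul_mul_gauge_mul_gauge]
  rw [e1] at hA1 hB1
  rw [approxCasoratian, approxCasoratian, e2, e1]
  simp only [one_mul, neg_one_mul] at hA hB hA1 hB1
  push_cast
  linear_combination ((k : ℝ) + 2) * approxSol P 1 (k + 1 + 1) * hA
    - ((k : ℝ) + 2) * approxSol P (-1) (k + 1 + 1) * hB
    + ((k : ℝ) + 2) * (((k : ℝ) + 1) * gauge (-1) ((k : ℝ) + 1) * residual P (-tSeq k)) * hB1
    - ((k : ℝ) + 2) * (((k : ℝ) + 1) * gauge 1 ((k : ℝ) + 1) * residual P (tSeq k)) * hA1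

theorem isBigO_approxCasoratian (p : ℕ) :
    (fun k => approxCasoratian (PowerSeries.trunc (2 * p + 5) cSeries) k - 2) =O[atTop]
      fun k : ℕ => ((k : ℝ) + 1)⁻¹ ^ p := by
  set P := PowerSeries.trunc (2 * p + 5) cSeries with hP
  refine isBigO_sub_of_tendsto p ?_ (tendsto_approxCasoratian (eval_zero_trunc_cSeries _))
  have hres : residual P =O[𝓝 0] fun t => t ^ (2 * p + 5) := isBigO_residual _
  have hneg : Tendsto (fun k => -tSeq k) atTop (𝓝 0) := by simpa using tendsto_tSeq.neg
  have r1 : (fun k => residual P (tSeq k)) =O[atTop] fun k => tSeq k ^ (2 * p + 5) :=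
    hres.comp_tendsto tendsto_tSeq
  have r2 : (fun k => residual P (-tSeq k)) =O[atTop] fun k => tSeq k ^ (2 * p + 5) :=
    (hres.comp_tendsto hneg).trans (isBigO_of_le _ fun k => by simp)
  have hc : ContinuousAt (fun t => gaugeRatio 1 t * P.eval (argShift 1 t)) 0 :=
    (continuousAt_gaugeRatio 1).mul (contDiffAt_eval_argShift P 1).continuousAt
  have b1 := isBigO_one_of_continuousAt hc tendsto_tSeq
  have b2 := isBigO_one_of_continuousAt hc hneg
  have b0 := isBigO_one_of_continuousAt (f := fun t => 1 + t ^ 2) (by fun_prop) tendsto_tSeq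
  have h := (b0.mul (isBigO_refl (fun k => (tSeq k)⁻¹) atTop)).mul ((r2.mul b1).sub (r1.mul b2))
  refine h.congr (fun k => (approxCasoratian_succ_sub P k).symm) fun k => ?_
  have h0 := (tSeq_pos k).ne'
  -- The order `2p + 5` loses one power to the prefactor `1/t`; the remaining `t^{2(p+2)}` is what
  -- the summation lemma requires.
  rw [← tSeq_sq, ← pow_mul, one_mul, mul_one, show 2 * p + 5 = 2 * (p + 2) + 1 by ring, pow_succ]
  field_simp

/-! ### Comparison of the quotients of solutions. -/

theorem gauge_one_sq {x : ℝ} (hx : 0 < x) :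
    gauge 1 x ^ 2 = (Real.exp (4 * √x))⁻¹ * (√x)⁻¹ ^ 3 := by
  have h1 := Real.sqrt_pos.2 hx
  have h2 := Real.sq_sqrt h1.le
  have h3 := Real.sqrt_pos.2 h1
  have h4 : Real.exp (-(2 * (1 * √x))) ^ 2 = (Real.exp (4 * √x))⁻¹ := by
    rw [← Real.exp_nat_mul, ← Real.exp_neg]
    congr 1
    push_cast
    ring
  rw [gauge, div_pow, h4, mul_pow, h2]
  field_simp

/-- The difference of the quotients of the exact and of the approximate solutions. -/
noncomputable def quotDiff (P : Polynomial ℝ) (k : ℕ) : ℝ :=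
  (a (k + 1)).re / bInt k
    - (2 * scaleConst ^ 2)⁻¹ * (approxSol P (-1) ((k : ℝ) + 1) / approxSol P 1 ((k : ℝ) + 1))

/-- The increment of a quotient of solutions is the Casoratian over the product of consecutive
denominators. The constant `(2 * scaleConst ^ 2)⁻¹` makes the leading terms cancel: the normalised
Casoratians tend to `1` and `2`, and `bInt` carries the factor `scaleConst`. -/
theorem quotDiff_succ_sub (P : Polynomial ℝ) {k : ℕ} (h0 : P.eval (tSeq k) ≠ 0)
    (h1 : P.eval (tSeq (k + 1)) ≠ 0) :
    quotDiff P (k + 1) - quotDiff P k =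
      Real.exp (4 * √((k : ℝ) + 1)) * (tSeq k * ((1 + tSeq k ^ 2)⁻¹ *
        ((scaleConst ^ 2)⁻¹ * (gaugeRatio 1 (tSeq k))⁻¹ *
        ((betaSeq k)⁻¹ * (betaSeq (k + 1))⁻¹ *
          ((P.eval (tSeq k))⁻¹ * (P.eval (tSeq (k + 1)))⁻¹) *
          (P.eval (tSeq k) * P.eval (tSeq (k + 1)) - approxCasoratian P k / 2 *
            (betaSeq k * betaSeq (k + 1))))))) := by
  have hs := scaleConst_pos.ne'
  have hg := (gauge_pos 1 (by positivity : 0 < (k : ℝ) + 1)).ne'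
  have hg1 := (gauge_pos 1 (by positivity : 0 < ((k + 1 : ℕ) : ℝ) + 1)).ne'
  have hβ := (betaSeq_pos k).ne'
  have hβ1 := (betaSeq_pos (k + 1)).ne'
  have ht := (tSeq_pos k).ne'
  have hy := (bInt_pos k).ne'
  have hy1 := (bInt_pos (k + 1)).ne'
  have hE := (Real.exp_pos (4 * √((k : ℝ) + 1))).ne'
  have hgr := gauge_natCast_add (one_pow 2) k 1
  rw [one_mul, Nat.cast_one] at hgr
  have hr0 : gaugeRatio 1 (tSeq k) ≠ 0 := by
    intro h
    rw [h, mul_zero] at hgr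
    exact hg1 hgr
  have hB : approxSol P 1 ((k : ℝ) + 1) = gauge 1 ((k : ℝ) + 1) * P.eval (tSeq k) := by
    rw [approxSol_natCast_add_one, one_mul]
  have hB1 : approxSol P 1 (((k + 1 : ℕ) : ℝ) + 1) =
      gauge 1 ((k : ℝ) + 1) * gaugeRatio 1 (tSeq k) * P.eval (tSeq (k + 1)) := by
    rw [approxSol_natCast_add_one, one_mul, hgr]
  have hBne : approxSol P 1 ((k : ℝ) + 1) ≠ 0 := by rw [hB]; positivity
  have hB1ne : approxSol P 1 (((k + 1 : ℕ) : ℝ) + 1) ≠ 0 := by rw [hB1]; positivity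
  have hk1 : ((k : ℝ) + 1) ≠ 0 := by positivity
  have hk2 : ((k : ℝ) + 2) ≠ 0 := by positivity
  have hcas := casoratian k
  have hw : approxSol P (-1) ((k + 1 : ℕ) + 1) * approxSol P 1 (k + 1)
      - approxSol P (-1) (k + 1) * approxSol P 1 ((k + 1 : ℕ) + 1) =
      approxCasoratian P k / (((k : ℝ) + 1) * ((k : ℝ) + 2)) := by
    rw [approxCasoratian]
    field_simp
  have hstep : quotDiff P (k + 1) - quotDiff P k =
      (((k : ℝ) + 1) * ((k : ℝ) + 2))⁻¹ * ((bInt k * bInt (k + 1))⁻¹ -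
        (2 * scaleConst ^ 2)⁻¹ * approxCasoratian P k *
          (approxSol P 1 ((k : ℝ) + 1) * approxSol P 1 (((k + 1 : ℕ) : ℝ) + 1))⁻¹) := by
    have e1 : (a (k + 1 + 1)).re / bInt (k + 1) - (a (k + 1)).re / bInt k =
        (1 / (((k : ℝ) + 1) * ((k : ℝ) + 2))) * (bInt k * bInt (k + 1))⁻¹ := by
      rw [← hcas]
      field_simp
    have e2 : approxSol P (-1) (((k + 1 : ℕ) : ℝ) + 1) / approxSol P 1 (((k + 1 : ℕ) : ℝ) + 1)
        - approxSol P (-1) ((k : ℝ) + 1) / approxSol P 1 ((k : ℝ) + 1) =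
        approxCasoratian P k / (((k : ℝ) + 1) * ((k : ℝ) + 2)) *
          (approxSol P 1 ((k : ℝ) + 1) * approxSol P 1 (((k + 1 : ℕ) : ℝ) + 1))⁻¹ := by
      rw [← hw]
      field_simp
    rw [quotDiff, quotDiff]
    linear_combination e1 - (2 * scaleConst ^ 2)⁻¹ * e2
  have hn : (((k : ℝ) + 1) * ((k : ℝ) + 2))⁻¹ * (gauge 1 ((k : ℝ) + 1) ^ 2)⁻¹ =
      Real.exp (4 * √((k : ℝ) + 1)) * (tSeq k * (1 + tSeq k ^ 2)⁻¹) := by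
    have h := tSeq_sq k
    have e1 : ((k : ℝ) + 1) = (tSeq k ^ 2)⁻¹ := by rw [h, inv_inv]
    have e2 : ((k : ℝ) + 2) = (tSeq k ^ 2)⁻¹ + 1 := by rw [← e1]; ring
    rw [gauge_one_sq (by positivity)]
    change (((k : ℝ) + 1) * ((k : ℝ) + 2))⁻¹ *
      ((Real.exp (4 * √((k : ℝ) + 1)))⁻¹ * tSeq k ^ 3)⁻¹ = _
    have e3 : ((k : ℝ) + 1) * ((k : ℝ) + 2) = (1 + tSeq k ^ 2) / tSeq k ^ 4 := by
      rw [e2, e1]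
      field_simp
    rw [e3]
    field_simp
  rw [hstep, hB, hB1, bInt_eq_betaSeq, bInt_eq_betaSeq, hgr]
  calc _ = ((((k : ℝ) + 1) * ((k : ℝ) + 2))⁻¹ * (gauge 1 ((k : ℝ) + 1) ^ 2)⁻¹) *
      ((scaleConst ^ 2)⁻¹ * (gaugeRatio 1 (tSeq k))⁻¹ *
        ((betaSeq k)⁻¹ * (betaSeq (k + 1))⁻¹ *
          ((P.eval (tSeq k))⁻¹ * (P.eval (tSeq (k + 1)))⁻¹) *
          (P.eval (tSeq k) * P.eval (tSeq (k + 1)) - approxCasoratian P k / 2 *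
            (betaSeq k * betaSeq (k + 1))))) := by field_simp
    _ = _ := by rw [hn]; ring

theorem tendsto_eval_tSeq {P : Polynomial ℝ} (hP : P.eval 0 = 1) :
    Tendsto (fun k => P.eval (tSeq k)) atTop (𝓝 1) := by
  have := (P.continuous.tendsto 0).comp tendsto_tSeq
  rwa [hP] at this

theorem isBigO_one_inv {u : ℕ → ℝ} (h : Tendsto u atTop (𝓝 1)) :
    (fun k => (u k)⁻¹) =O[atTop] fun _ => (1 : ℝ) :=
  (h.inv₀ one_ne_zero).isBigO_one ℝ

theorem isBigO_quotDiff_succ_sub (p : ℕ) :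
    (fun k => quotDiff (PowerSeries.trunc (2 * p + 5) cSeries) (k + 1)
      - quotDiff (PowerSeries.trunc (2 * p + 5) cSeries) k) =O[atTop]
      fun k : ℕ => Real.exp (4 * √((k : ℝ) + 1)) * ((k : ℝ) + 1)⁻¹ ^ p := by
  set P := PowerSeries.trunc (2 * p + 5) cSeries with hP
  have hP0 : P.eval 0 = 1 := eval_zero_trunc_cSeries _
  have tP := tendsto_eval_tSeq hP0
  have tP1 := tP.comp (tendsto_add_atTop_nat 1)
  have tβ := tendsto_betaSeq
  have tβ1 := tβ.comp (tendsto_add_atTop_nat 1)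
  simp only [Function.comp_def] at tP1 tβ1
  have hδ : (fun k => betaSeq k - P.eval (tSeq k)) =O[atTop] fun k => tSeq k ^ (2 * p) :=
    (hasAsymp_betaSeq (2 * p + 5)).trans (isBigO_pow_pow_of_le tendsto_tSeq (by omega))
  have hw : (fun k => approxCasoratian P k - 2) =O[atTop] fun k => tSeq k ^ (2 * p) := by
    simpa only [pow_mul, tSeq_sq] using isBigO_approxCasoratian p
  have hdiff : (fun k => P.eval (tSeq k) * P.eval (tSeq (k + 1)) - approxCasoratian P k / 2 *
      (betaSeq k * betaSeq (k + 1))) =O[atTop] fun k => tSeq k ^ (2 * p) := by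
    have h1 := hδ.mul (tP1.isBigO_one ℝ)
    have h2 := (tβ.isBigO_one ℝ).mul (isBigO_tSeq_add 1 hδ)
    have h3 := (hw.const_mul_left (1 / 2)).mul ((tβ.mul tβ1).isBigO_one ℝ)
    simp only [mul_one, one_mul] at h1 h2 h3
    refine ((h1.add h2).add h3).neg_left.congr_left fun k => ?_
    ring
  have hR : Tendsto (fun k => gaugeRatio 1 (tSeq k)) atTop (𝓝 1) := by
    have := (continuousAt_gaugeRatio 1).tendsto.comp tendsto_tSeq
    rwa [gaugeRatio_zero] at this
  have hq : Tendsto (fun k => 1 + tSeq k ^ 2) atTop (𝓝 1) := by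
    simpa using (tendsto_tSeq.pow 2).const_add 1
  have hbnd := ((((isBigO_one_inv tβ).mul (isBigO_one_inv tβ1)).mul
    ((isBigO_one_inv tP).mul (isBigO_one_inv tP1))).mul hdiff)
  have hall := (isBigO_refl (fun k : ℕ => Real.exp (4 * √((k : ℝ) + 1))) atTop).mul
    ((tendsto_tSeq.isBigO_one ℝ).mul ((isBigO_one_inv hq).mul
      (((isBigO_one_inv hR).const_mul_left (scaleConst ^ 2)⁻¹).mul hbnd)))
  refine hall.congr' ?_ ?_
  · filter_upwards [tP.eventually_ne one_ne_zero, tP1.eventually_ne one_ne_zero] with k h0 h1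
    rw [quotDiff_succ_sub P h0 h1]
  · refine Eventually.of_forall fun k => ?_
    simp only [one_mul, pow_mul, tSeq_sq]

/-- The increments of `e^{4√x} / x^m` exceed `e^{4√x} / x^m` divided by `x + 1`, so summation costs
one power of `x`. The undetermined multiple of the recessive solution in `a` is only an additive
constant here. -/
theorem isBigO_quotDiff (m : ℕ) :
    quotDiff (PowerSeries.trunc (2 * (m + 1) + 5) cSeries) =O[atTop]
      fun k : ℕ => Real.exp (4 * √((k : ℝ) + 1)) / ((k : ℝ) + 1) ^ m := by
  obtain ⟨C, hC0, hC⟩ := (isBigO_quotDiff_succ_sub (m + 1)).exists_pos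
  rw [IsBigOWith] at hC
  have hx : Tendsto (fun k : ℕ => (k : ℝ) + 1) atTop atTop :=
    tendsto_atTop_add_const_right _ _ tendsto_natCast_atTop_atTop
  obtain ⟨K, hK⟩ := eventually_atTop.1
    (hC.and (hx.eventually (eventually_exp_sqrt_div_pow_growth m)))
  have hgrow : ∀ k, K ≤ k → Real.exp (4 * √((k : ℝ) + 1)) / ((k : ℝ) + 1) ^ m *
      ((k : ℝ) + 1 + 1)⁻¹ ≤ Real.exp (4 * √(((k + 1 : ℕ) : ℝ) + 1)) / (((k + 1 : ℕ) : ℝ) + 1) ^ m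
        - Real.exp (4 * √((k : ℝ) + 1)) / ((k : ℝ) + 1) ^ m := fun k hk => by
    have := (hK k hk).2
    push_cast
    linarith
  refine isBigO_of_sub_le (C := 2 * C) (K := K) (fun k _ => by positivity) (fun k hk => ?_)
    (fun k hk => ?_)
  · have h1 := (hK k hk).1
    rw [Real.norm_of_nonneg (by positivity : (0 : ℝ) ≤
      Real.exp (4 * √((k : ℝ) + 1)) * ((k : ℝ) + 1)⁻¹ ^ (m + 1))] at h1
    refine h1.trans ?_
    have h2 : ((k : ℝ) + 1)⁻¹ ≤ 2 * ((k : ℝ) + 1 + 1)⁻¹ := by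
      have hk0 : (0 : ℝ) ≤ k := k.cast_nonneg
      rw [← div_eq_mul_inv, inv_eq_one_div, div_le_div_iff₀ (by positivity) (by positivity)]
      linarith
    calc C * (Real.exp (4 * √((k : ℝ) + 1)) * ((k : ℝ) + 1)⁻¹ ^ (m + 1))
        = C * (Real.exp (4 * √((k : ℝ) + 1)) / ((k : ℝ) + 1) ^ m * ((k : ℝ) + 1)⁻¹) := by
          rw [pow_succ, inv_pow]
          ring
      _ ≤ C * (Real.exp (4 * √((k : ℝ) + 1)) / ((k : ℝ) + 1) ^ m *
          (2 * ((k : ℝ) + 1 + 1)⁻¹)) := by gcongr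
      _ = 2 * C * (Real.exp (4 * √((k : ℝ) + 1)) / ((k : ℝ) + 1) ^ m * ((k : ℝ) + 1 + 1)⁻¹) := by
          ring
      _ ≤ _ := by gcongr; exact hgrow k hk
  · have h1 := hgrow k hk
    have h2 : 0 ≤ Real.exp (4 * √((k : ℝ) + 1)) / ((k : ℝ) + 1) ^ m * ((k : ℝ) + 1 + 1)⁻¹ := by
      positivity
    linarith

/-- Write `a · bInt = bInt² · (a / bInt)`. The decay `e^{-4√n} n^{-3/2}` of `bInt²` turns the error
of the quotient into `O(n^{-m-3/2})`. -/
theorem isBigO_mul_bInt_sub (m : ℕ) :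
    (fun k => (a (k + 1)).re * bInt k - tSeq k ^ 3 / 2 *
      ((PowerSeries.trunc (2 * (m + 1) + 5) cSeries).eval (tSeq k) *
        (PowerSeries.trunc (2 * (m + 1) + 5) cSeries).eval (-tSeq k)))
      =O[atTop] fun k => tSeq k ^ (2 * m + 3) := by
  have hD := isBigO_quotDiff m
  set P := PowerSeries.trunc (2 * (m + 1) + 5) cSeries with hP
  have hP0 : P.eval 0 = 1 := eval_zero_trunc_cSeries _
  have tP := tendsto_eval_tSeq hP0
  have tPn : Tendsto (fun k => P.eval (-tSeq k)) atTop (𝓝 (P.eval 0)) :=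
    (P.continuous.tendsto 0).comp (by simpa using tendsto_tSeq.neg)
  have tβ := tendsto_betaSeq
  have hδ : (fun k => betaSeq k - P.eval (tSeq k)) =O[atTop] fun k => tSeq k ^ (2 * m) :=
    (hasAsymp_betaSeq (2 * (m + 1) + 5)).trans (isBigO_pow_pow_of_le tendsto_tSeq (by omega))
  have h1 : (fun k : ℕ => scaleConst ^ 2 * (gauge 1 ((k : ℝ) + 1) ^ 2 * betaSeq k ^ 2) *
      quotDiff P k) =O[atTop] fun k => tSeq k ^ (2 * m + 3) := by
    have hβ2 := (tβ.pow 2).isBigO_one ℝ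
    have := (((isBigO_refl (fun k : ℕ => gauge 1 ((k : ℝ) + 1) ^ 2) atTop).mul
      hβ2).const_mul_left (scaleConst ^ 2)).mul hD
    refine this.congr_right fun k => ?_
    have hE := (Real.exp_pos (4 * √((k : ℝ) + 1))).ne'
    rw [mul_one, gauge_one_sq (by positivity)]
    change (Real.exp (4 * √((k : ℝ) + 1)))⁻¹ * tSeq k ^ 3 * _ = _
    rw [pow_add, pow_mul, tSeq_sq, inv_pow]
    field_simp
  -- Here `betaSeq²` is replaced by `P(t)²`, with their difference factored.
  have h2 : (fun k => tSeq k ^ 3 / 2 * (P.eval (-tSeq k) * (P.eval (tSeq k))⁻¹ *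
      ((betaSeq k + P.eval (tSeq k)) * (betaSeq k - P.eval (tSeq k))))) =O[atTop]
      fun k => tSeq k ^ (2 * m + 3) := by
    have := ((isBigO_refl (fun k => tSeq k ^ 3) atTop).const_mul_left (1 / 2)).mul
      (((tPn.isBigO_one ℝ).mul (isBigO_one_inv tP)).mul (((tβ.add tP).isBigO_one ℝ).mul hδ))
    refine this.congr (fun k => by ring) fun k => by ring
  refine (h1.add h2).congr' ?_ EventuallyEq.rfl
  filter_upwards [tP.eventually_ne one_ne_zero] with k hk
  have hg := (gauge_pos 1 (by positivity : 0 < (k : ℝ) + 1)).ne'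
  have hs := scaleConst_pos.ne'
  have hβ := (betaSeq_pos k).ne'
  have hgg : gauge 1 ((k : ℝ) + 1) * gauge (-1) ((k : ℝ) + 1) = tSeq k ^ 3 :=
    gauge_mul_gauge_neg (by positivity)
  rw [quotDiff, bInt_eq_betaSeq, approxSol_natCast_add_one, approxSol_natCast_add_one, ← hgg,
    one_mul, neg_one_mul]
  field_simp
  ring

/-! ### Identification of the coefficients `d_k` and conclusion. -/

theorem coeff_trunc_mul_comp_neg {M i : ℕ} (hi : i < M) :
    (PowerSeries.trunc M cSeries * (PowerSeries.trunc M cSeries).comp (-Polynomial.X)).coeff i =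
      ∑ x ∈ Finset.HasAntidiagonal.antidiagonal i, ((-1) ^ x.1 * c x.1 * c x.2 : ℝ) := by
  rw [Polynomial.coeff_mul]
  refine Finset.sum_congr rfl fun x hx => ?_
  have hx := Finset.HasAntidiagonal.mem_antidiagonal.1 hx
  have h1 : (PowerSeries.trunc M cSeries).coeff x.1 = (-1) ^ x.1 * c x.1 := by
    rw [PowerSeries.coeff_trunc, if_pos (by omega), cSeries, PowerSeries.coeff_mk]
    push_cast
    rfl
  have h2 : (PowerSeries.trunc M cSeries).coeff x.2 = (-1) ^ x.2 * c x.2 := by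
    rw [PowerSeries.coeff_trunc, if_pos (by omega), cSeries, PowerSeries.coeff_mk]
    push_cast
    rfl
  have h3 : ((-1 : ℝ) ^ x.2) * (-1) ^ x.2 = 1 := by rw [← mul_pow]; simp
  rw [h1, show -Polynomial.X = Polynomial.C (-1 : ℝ) * Polynomial.X by simp,
    Polynomial.comp_C_mul_X_coeff, h2]
  linear_combination (-1 : ℝ) ^ x.1 * c x.1 * c x.2 * h3

/-- `P(t) P(-t)` is even: swapping the two indices changes the sign of the sum. -/
theorem sum_antidiagonal_odd {i : ℕ} (hi : Odd i) :
    ∑ x ∈ Finset.HasAntidiagonal.antidiagonal i, ((-1) ^ x.1 * c x.1 * c x.2 : ℝ) = 0 := by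
  have h : ∑ x ∈ Finset.HasAntidiagonal.antidiagonal i, ((-1) ^ x.1 * c x.1 * c x.2 : ℝ) =
      -∑ x ∈ Finset.HasAntidiagonal.antidiagonal i, ((-1) ^ x.1 * c x.1 * c x.2 : ℝ) := by
    rw [← Finset.sum_neg_distrib, ← Finset.Nat.sum_antidiagonal_swap]
    refine Finset.sum_congr rfl fun x hx => ?_
    have h1 : (-1 : ℝ) ^ x.1 * (-1) ^ x.2 = -1 := by
      rw [← pow_add, Finset.HasAntidiagonal.mem_antidiagonal.1 hx, hi.neg_one_pow]
    have h2 : (-1 : ℝ) ^ x.1 * (-1) ^ x.1 = 1 := by rw [← mul_pow]; simp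
    have h3 : (-1 : ℝ) ^ x.2 = -(-1) ^ x.1 := by
      linear_combination (-1 : ℝ) ^ x.1 * h1 - (-1 : ℝ) ^ x.2 * h2
    simp only [Prod.fst_swap, Prod.snd_swap]
    rw [h3]
    ring
  linarith

theorem sum_antidiagonal_even (j : ℕ) :
    ∑ x ∈ Finset.HasAntidiagonal.antidiagonal (2 * j), ((-1) ^ x.1 * c x.1 * c x.2 : ℝ) = d j := by
  rw [Finset.Nat.sum_antidiagonal_eq_sum_range_succ_mk, d]
  push_cast
  rfl

theorem isBigO_eval_mul_eval_neg_sub {M m : ℕ} (h : 2 * m ≤ M) :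
    (fun k => (PowerSeries.trunc M cSeries).eval (tSeq k) *
      (PowerSeries.trunc M cSeries).eval (-tSeq k)
      - ∑ j ∈ Finset.range m, (d j : ℝ) * tSeq k ^ (2 * j)) =O[atTop]
      fun k => tSeq k ^ (2 * m) := by
  have h1 := isBigO_eval_of_coeff_eq_zero tendsto_tSeq (N := 2 * m)
    (p := PowerSeries.trunc M cSeries * (PowerSeries.trunc M cSeries).comp (-Polynomial.X)
      - ∑ j ∈ Finset.range m, Polynomial.monomial (2 * j) (d j : ℝ)) (fun i hi => by
      rw [Polynomial.coeff_sub, coeff_trunc_mul_comp_neg (hi.trans_le h),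
        Polynomial.finsetSum_coeff]
      simp only [Polynomial.coeff_monomial]
      rcases Nat.even_or_odd' i with ⟨j, rfl | rfl⟩
      · rw [sum_antidiagonal_even, Finset.sum_eq_single j]
        · simp
        · intro b _ hb
          rw [if_neg (by omega)]
        · intro hj
          exact absurd (Finset.mem_range.2 (by omega)) hj
      · rw [sum_antidiagonal_odd ⟨j, rfl⟩, Finset.sum_eq_zero, sub_zero]
        intro b _
        rw [if_neg (by omega)])
  refine h1.congr_left fun k => ?_
  rw [Polynomial.eval_sub, Polynomial.eval_mul, Polynomial.eval_comp, Polynomial.eval_finsetSum]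
  simp [Polynomial.eval_monomial]

theorem isBigO_mul_bInt (m : ℕ) :
    (fun k => (a (k + 1)).re * bInt k - tSeq k ^ 3 / 2 *
      ∑ j ∈ Finset.range m, (d j : ℝ) * tSeq k ^ (2 * j))
      =O[atTop] fun k => tSeq k ^ (2 * m + 3) := by
  have h1 := isBigO_mul_bInt_sub m
  have h2 := ((isBigO_refl (fun k => tSeq k ^ 3) atTop).const_mul_left (1 / 2)).mul
    (isBigO_eval_mul_eval_neg_sub (show 2 * m ≤ 2 * (m + 1) + 5 by omega))
  have h3 := h2.congr_right (g₂ := fun k => tSeq k ^ (2 * m + 3)) fun k => by ring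
  refine (h1.add h3).congr_left fun k => ?_
  ring

theorem rho_succ (k : ℕ) : rho (k + 1) = -(((a (k + 1)).re * bInt k : ℝ) : ℂ) := by
  rw [rho, b_succ, a_eq_re]
  push_cast
  simp

theorem tSeq_pow_eq_rpow (k m : ℕ) :
    tSeq k ^ (2 * m + 3) = ((k + 1 : ℕ) : ℝ) ^ (-(3 / 2 : ℝ) - (m : ℝ)) := by
  have hx : (0 : ℝ) < ((k + 1 : ℕ) : ℝ) := by positivity
  have h : tSeq k = ((k + 1 : ℕ) : ℝ) ^ (-(1 / 2) : ℝ) := by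
    rw [tSeq, Real.rpow_neg hx.le, ← Real.sqrt_eq_rpow]
    push_cast
    rfl
  rw [h, ← Real.rpow_natCast, ← Real.rpow_mul hx.le]
  congr 1
  push_cast
  ring

end ExpIntegral

theorem corollary2 :
    ExpIntegral.d 0 = 1 ∧
    ∀ m : ℕ,
      (fun n : ℕ => ExpIntegral.rho n -
        (-(1 / (2 * (((n : ℝ) ^ (3 / 2 : ℝ) : ℝ) : ℂ))) *
          ∑ k ∈ Finset.range m, (ExpIntegral.d k : ℂ) * ((n : ℂ) ^ k)⁻¹))
      =O[Filter.atTop] (fun n : ℕ => (n : ℝ) ^ (-(3 / 2 : ℝ) - (m : ℝ))) := by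
  refine ⟨ExpIntegral.d_zero, fun m => ?_⟩
  -- Put `n = k + 1`, the index at which `tSeq k = n^{-1/2}` and `b_n = -bInt k`; the value at `n =
  -- 0` is irrelevant.
  rw [← Filter.map_add_atTop_eq_nat 1, Asymptotics.isBigO_map]
  refine ((ExpIntegral.isBigO_mul_bInt m).norm_left.congr
    (f₂ := fun k => ‖ExpIntegral.rho (k + 1) -
        (-(1 / (2 * ((((k + 1 : ℕ) : ℝ) ^ (3 / 2 : ℝ) : ℝ) : ℂ))) *
          ∑ j ∈ Finset.range m, (ExpIntegral.d j : ℂ) * (((k + 1 : ℕ) : ℂ) ^ j)⁻¹)‖)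
    (fun k => ?_) (fun k => ExpIntegral.tSeq_pow_eq_rpow k m)).of_norm_left
  have h1 : (((k + 1 : ℕ) : ℝ) ^ (3 / 2 : ℝ)) = (ExpIntegral.tSeq k ^ 3)⁻¹ := by
    have := ExpIntegral.tSeq_pow_eq_rpow k 0
    rw [Nat.mul_zero, zero_add, Nat.cast_zero, sub_zero, Real.rpow_neg (by positivity)] at this
    rw [this, inv_inv]
  have h2 : ∀ j : ℕ, (((k + 1 : ℕ) : ℂ) ^ j)⁻¹ = ((ExpIntegral.tSeq k ^ (2 * j) : ℝ) : ℂ) := by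
    intro j
    rw [pow_mul, ExpIntegral.tSeq_sq]
    push_cast
    rw [inv_pow]
  simp_rw [h2]
  rw [← Complex.norm_real, ← norm_neg, ExpIntegral.rho_succ, h1]
  congr 1
  have ht : (ExpIntegral.tSeq k : ℂ) ≠ 0 := by exact_mod_cast (ExpIntegral.tSeq_pos k).ne'
  push_cast
  field_simp
  ring
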